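/- **Theorem.** Let $n\ge 2$ be an integer and let $P\subset\mathbb R^2$ be an integer polygon that contains no point of the lattice $n\mathbb Z^2=(n\mathbb Z)\times(n\mathbb Z)$. Then there is an affine automorphism $\varphi$ of $n\mathbb Z^2$ such that $\varphi(P)$ is a polygon of one of the types I$_n$–VI$_n$ defined below. Here a *polygon* is the convex hull of a finite set of points of $\mathbb R^2$ that has nonempty interior; it is an *integer polygon* if all its vertices belong to $\mathbb Z^2$. An *affine automorphism* of $n\mathbb Z^2$ is an affine transformation of $\mathbb R^2$ mapping $n\mathbb Z^2$ onto itself. $[\mathbf a,\mathbf b]$ is the closed segment with endpoints $\mathbf a,\mathbf b$, and $\mathbf 0=(0,0)$. A line or a segment *splits* a polygon if it divides the polygon into two parts with nonempty interior. An integer polygon $Q$ free of points of $n\mathbb Z^2$ is a - *type I$_n$ polygon* if it lies in a slab of the form $jn\le x_1\le (j+1)n$ or of the form $jn\le x_2\le (j+1)n$ with $j\in\mathbb Z$; - *type II$_n$ polygon* if each of the segments $[\mathbf 0,(n,0)]$, $[(n,0),(n,n)]$, $[(0,n),(n,n)]$, $[\mathbf 0,(0,n)]$ splits $Q$; - *type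 III$_n$ polygon* if each of the segments $[\mathbf 0,(n,0)]$, $[(n,0),(n,n)]$, $[(n,n),(0,n)]$ splits $Q$ and the line $x_1=0$ does not split $Q$; - *type IV$_n$ polygon* if each of the segments $[\mathbf 0,(0,n)]$, $[\mathbf 0,(n,0)]$, $[(n,0),(n,n)]$, $[(n,n),(2n,n)]$ splits $Q$ and $Q$ has no common points with the lines $x_1=-n$ and $x_1=2n$; - *type V$_n$ polygon* if each of the segments $[\mathbf 0,(-n,0)]$, $[\mathbf 0,(0,n)]$ splits $Q$ and the lines $x_1=-n$ and $x_2=n$ do not split $Q$; - *type VI$_n$ polygon* if each of the segments $[\mathbf 0,(-n,0)]$, $[\mathbf 0,(0,n)]$, $[(0,n),(n,n)]$ splits $Q$ and the lines $x_1=n$ and $x_1=-n$ do not split $Q$. -/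

import Mathlib

/-- The integer lattice `ℤ²` in the plane `ℝ²`. -/
def integerLattice : Set (ℝ × ℝ) :=
  {p | ∃ u v : ℤ, p = ((u : ℝ), (v : ℝ))}

/-- The lattice `nℤ² = (nℤ) × (nℤ)` in the plane `ℝ²`. -/
def scaledLattice (n : ℤ) : Set (ℝ × ℝ) :=
  {p | ∃ u v : ℤ, p = ((n : ℝ) * u, (n : ℝ) * v)}

/-- A (convex) polygon: the convex hull of a finite set of points of the plane that has
nonempty interior. -/
def IsConvexPolygon (P : Set (ℝ × ℝ)) : Prop :=
  (∃ S : Finset (ℝ × ℝ), P = convexHull ℝ (S : Set (ℝ × ℝ))) ∧ (interior P).Nonempty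

/-- An integer polygon: a convex polygon all of whose vertices (extreme points) belong
to `ℤ²`. -/
def IsIntegerPolygon (P : Set (ℝ × ℝ)) : Prop :=
  IsConvexPolygon P ∧ P.extremePoints ℝ ⊆ integerLattice

/-- An integer polygon (the whole closed region) that contains no point of `nℤ²`. -/
def IsFreeIntegerPolygon (n : ℤ) (P : Set (ℝ × ℝ)) : Prop :=
  IsIntegerPolygon P ∧ Disjoint P (scaledLattice n)

/-- A set `S` (below: a line or a segment) splits `P` if it divides `P` into two parts with
nonempty interior: `P \ S` is the union of two sets `A`, `B` with nonempty interior that are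
separated from each other, i.e. neither of them meets the closure of the other one. -/
def Splits (S P : Set (ℝ × ℝ)) : Prop :=
  ∃ A B : Set (ℝ × ℝ), A ∪ B = P \ S ∧
    (interior A).Nonempty ∧ (interior B).Nonempty ∧
    Disjoint (closure A) B ∧ Disjoint A (closure B)

/-- The vertical line `x₁ = c`. -/
def vLine (c : ℝ) : Set (ℝ × ℝ) := {p | p.1 = c}

/-- The horizontal line `x₂ = c`. -/
def hLine (c : ℝ) : Set (ℝ × ℝ) := {p | p.2 = c}

/-- Type I: `P` lies in a slab `jn ≤ x₁ ≤ (j+1)n` or in a slab `jn ≤ x₂ ≤ (j+1)n`. -/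
def IsTypeI (n : ℤ) (P : Set (ℝ × ℝ)) : Prop :=
  IsFreeIntegerPolygon n P ∧
    ∃ j : ℤ, (∀ p ∈ P, (j : ℝ) * n ≤ p.1 ∧ p.1 ≤ ((j : ℝ) + 1) * n) ∨
      (∀ p ∈ P, (j : ℝ) * n ≤ p.2 ∧ p.2 ≤ ((j : ℝ) + 1) * n)

/-- Type II. -/
def IsTypeII (n : ℤ) (P : Set (ℝ × ℝ)) : Prop :=
  IsFreeIntegerPolygon n P ∧
    Splits (segment ℝ (0, 0) ((n : ℝ), 0)) P ∧
    Splits (segment ℝ ((n : ℝ), 0) ((n : ℝ), (n : ℝ))) P ∧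
    Splits (segment ℝ (0, (n : ℝ)) ((n : ℝ), (n : ℝ))) P ∧
    Splits (segment ℝ (0, 0) (0, (n : ℝ))) P

/-- Type III. -/
def IsTypeIII (n : ℤ) (P : Set (ℝ × ℝ)) : Prop :=
  IsFreeIntegerPolygon n P ∧
    Splits (segment ℝ (0, 0) ((n : ℝ), 0)) P ∧
    Splits (segment ℝ ((n : ℝ), 0) ((n : ℝ), (n : ℝ))) P ∧
    Splits (segment ℝ ((n : ℝ), (n : ℝ)) (0, (n : ℝ))) P ∧
    ¬ Splits (vLine 0) P

/-- Type IV. -/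
def IsTypeIV (n : ℤ) (P : Set (ℝ × ℝ)) : Prop :=
  IsFreeIntegerPolygon n P ∧
    Splits (segment ℝ (0, 0) (0, (n : ℝ))) P ∧
    Splits (segment ℝ (0, 0) ((n : ℝ), 0)) P ∧
    Splits (segment ℝ ((n : ℝ), 0) ((n : ℝ), (n : ℝ))) P ∧
    Splits (segment ℝ ((n : ℝ), (n : ℝ)) (2 * (n : ℝ), (n : ℝ))) P ∧
    Disjoint P (vLine (-(n : ℝ))) ∧ Disjoint P (vLine (2 * (n : ℝ)))

/-- Type V. -/
def IsTypeV (n : ℤ) (P : Set (ℝ × ℝ)) : Prop :=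
  IsFreeIntegerPolygon n P ∧
    Splits (segment ℝ (0, 0) (-(n : ℝ), 0)) P ∧
    Splits (segment ℝ (0, 0) (0, (n : ℝ))) P ∧
    ¬ Splits (vLine (-(n : ℝ))) P ∧ ¬ Splits (hLine (n : ℝ)) P

/-- Type VI. -/
def IsTypeVI (n : ℤ) (P : Set (ℝ × ℝ)) : Prop :=
  IsFreeIntegerPolygon n P ∧
    Splits (segment ℝ (0, 0) (-(n : ℝ), 0)) P ∧
    Splits (segment ℝ (0, 0) (0, (n : ℝ))) P ∧
    Splits (segment ℝ (0, (n : ℝ)) ((n : ℝ), (n : ℝ))) P ∧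
    ¬ Splits (vLine (n : ℝ)) P ∧ ¬ Splits (vLine (-(n : ℝ))) P

/-- An affine automorphism of the lattice `Λ`: an affine transformation of the plane that maps
`Λ` onto itself. -/
def IsAffineAutomorphism (φ : (ℝ × ℝ) ≃ᵃ[ℝ] (ℝ × ℝ)) (Λ : Set (ℝ × ℝ)) : Prop :=
  φ '' Λ = Λ

/-! Scale by `1/n`: the body `K = P/n` is convex and misses `ℤ²`, and affine automorphisms of `nℤ²`
become integer affine maps of determinant `±1`. The theorem rests on a bound for the lattice width
of `K`, followed by an analysis of bodies in narrow slabs.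

Width bound (`IsFreeBody.false_of_wide`). Since `P` is the hull of integer points, some primitive
direction attains the least width; make it `x₁` and suppose this width is at least 3. Long chords of
`K` realising the widths along `x₁`, `x₂` and `x₁ - x₂` express two vectors of a lattice basis as
elements of `s(K - K)` and `t(K - K)` with `s + t ≤ 1`. Convexity then puts into `K` a parallelogram
spanned by that basis, and such a parallelogram contains a lattice point.

Narrow slabs. Width below 3 lets a translate of `K` fit into `-2 < x₁ < 2`. The recurring tool is
that `K` meets a lattice line inside a single unit gap, so one chord with a known crossing controls
all others. In the width-four slab (`IsTriple.classified`), if `K` reaches both `x₁ = -1` and `x₁ =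
1`, the gaps on three consecutive lines force `K` into an open slab of width three in another
lattice direction. In the width-three slab (`IsWide.classified`), the unit edges crossed on `x₂ = 0`
and `x₂ = 1` determine the type or lead to a slab of width two. In the width-two slab
(`IsCentral.classified`), a suitable shear leaves only recognisable types. Finally, crossed unit
edges are translated back into splitting segments of length `n`. -/

/-- A convex set with nonempty interior that contains no point of `ℤ²`. -/
structure IsFreeBody (K : Set (ℝ × ℝ)) : Prop where
  convex : Convex ℝ K
  free : ∀ u v : ℤ, ((u : ℝ), (v : ℝ)) ∉ K
  nonempty_interior : (interior K).Nonempty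

/-! ### Unimodular changes of coordinates -/

/-- An affine map of the plane with integer coefficients and determinant `±1`. -/
structure UnimodularMap where
  (a b c d e f : ℤ)
  det : a * d - b * c = 1 ∨ a * d - b * c = -1

namespace UnimodularMap

/-- The action of a unimodular map on the plane. -/
def toFun (g : UnimodularMap) (p : ℝ × ℝ) : ℝ × ℝ :=
  (g.a * p.1 + g.b * p.2 + g.e, g.c * p.1 + g.d * p.2 + g.f)

/-- The preimage of a set under a unimodular map. -/
def pre (g : UnimodularMap) (K : Set (ℝ × ℝ)) : Set (ℝ × ℝ) := g.toFun ⁻¹' K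

/-- Composition of unimodular maps. -/
def comp (g h : UnimodularMap) : UnimodularMap where
  a := g.a * h.a + g.b * h.c
  b := g.a * h.b + g.b * h.d
  c := g.c * h.a + g.d * h.c
  d := g.c * h.b + g.d * h.d
  e := g.a * h.e + g.b * h.f + g.e
  f := g.c * h.e + g.d * h.f + g.f
  det := by
    have key : (g.a * h.a + g.b * h.c) * (g.c * h.b + g.d * h.d)
        - (g.a * h.b + g.b * h.d) * (g.c * h.a + g.d * h.c)
        = (g.a * g.d - g.b * g.c) * (h.a * h.d - h.b * h.c) := by ring
    rw [key]
    rcases g.det with h1 | h1 <;> rcases h.det with h2 | h2 <;> simp [h1, h2]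

lemma toFun_comp (g h : UnimodularMap) (p : ℝ × ℝ) :
    (g.comp h).toFun p = g.toFun (h.toFun p) := by
  simp only [toFun, comp, Prod.mk.injEq]
  push_cast
  constructor <;> ring

lemma pre_comp (g h : UnimodularMap) (K : Set (ℝ × ℝ)) :
    (g.comp h).pre K = h.pre (g.pre K) := by
  ext p
  simp only [pre, Set.mem_preimage, toFun_comp]

lemma continuous_toFun (g : UnimodularMap) : Continuous g.toFun := by
  unfold toFun
  fun_prop

lemma det_sq (g : UnimodularMap) :
    ((g.a : ℝ) * g.d - g.b * g.c) * ((g.a : ℝ) * g.d - g.b * g.c) = 1 := by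
  have : (g.a * g.d - g.b * g.c) * (g.a * g.d - g.b * g.c) = 1 := by
    rcases g.det with h | h <;> simp [h]
  exact_mod_cast this

/-- The inverse of a unimodular map. -/
def inv (g : UnimodularMap) : UnimodularMap where
  a := (g.a * g.d - g.b * g.c) * g.d
  b := -((g.a * g.d - g.b * g.c) * g.b)
  c := -((g.a * g.d - g.b * g.c) * g.c)
  d := (g.a * g.d - g.b * g.c) * g.a
  e := (g.a * g.d - g.b * g.c) * (g.b * g.f - g.d * g.e)
  f := (g.a * g.d - g.b * g.c) * (g.c * g.e - g.a * g.f)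
  det := by
    have key : (g.a * g.d - g.b * g.c) * g.d * ((g.a * g.d - g.b * g.c) * g.a)
        - -((g.a * g.d - g.b * g.c) * g.b) * -((g.a * g.d - g.b * g.c) * g.c)
        = (g.a * g.d - g.b * g.c) ^ 3 := by ring
    rw [key]
    rcases g.det with h | h <;> simp [h]

lemma toFun_inv (g : UnimodularMap) (p : ℝ × ℝ) : g.toFun (g.inv.toFun p) = p := by
  have h := g.det_sq
  ext
  · simp only [toFun, inv]
    push_cast
    linear_combination (p.1 - g.e) * h
  · simp only [toFun, inv]
    push_cast
    linear_combination (p.2 - g.f) * h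

lemma inv_toFun (g : UnimodularMap) (p : ℝ × ℝ) : g.inv.toFun (g.toFun p) = p := by
  have h := g.det_sq
  ext
  · simp only [toFun, inv]
    push_cast
    linear_combination p.1 * h
  · simp only [toFun, inv]
    push_cast
    linear_combination p.2 * h

/-- The map exchanging the two coordinates. -/
def swap : UnimodularMap := ⟨0, 1, 1, 0, 0, 0, by simp⟩

lemma mem_swap {K : Set (ℝ × ℝ)} {x y : ℝ} :
    (x, y) ∈ swap.pre K ↔ (y, x) ∈ K := by
  simp [pre, toFun, swap]

end UnimodularMap

lemma IsFreeBody.pre {K : Set (ℝ × ℝ)} (hK : IsFreeBody K) (g : UnimodularMap) :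
    IsFreeBody (g.pre K) where
  convex := by
    intro p hp q hq s t hs ht hst
    have h := hK.convex hp hq hs ht hst
    have e : g.toFun (s • p + t • q) = s • g.toFun p + t • g.toFun q := by
      ext
      · simp only [UnimodularMap.toFun, Prod.fst_add, Prod.smul_fst, smul_eq_mul, Prod.snd_add,
          Prod.smul_snd]
        linear_combination (-(g.e : ℝ)) * hst
      · simp only [UnimodularMap.toFun, Prod.fst_add, Prod.smul_fst, smul_eq_mul, Prod.snd_add,
          Prod.smul_snd]
        linear_combination (-(g.f : ℝ)) * hst
    simpa only [UnimodularMap.pre, Set.mem_preimage, e] using h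
  free := by
    intro u v h
    refine hK.free (g.a * u + g.b * v + g.e) (g.c * u + g.d * v + g.f) ?_
    simpa [UnimodularMap.pre, UnimodularMap.toFun] using h
  nonempty_interior := by
    obtain ⟨p, hp⟩ := hK.nonempty_interior
    refine ⟨g.inv.toFun p, ?_⟩
    refine preimage_interior_subset_interior_preimage g.continuous_toFun ?_
    simpa only [Set.mem_preimage, UnimodularMap.toFun_inv] using hp

/-! ### Crossed unit edges and the types for `ℤ²` -/

/-- `K` has points on both sides of the line `x₂ = j` and meets it between `x₁ = i` and
`x₁ = i + 1`. -/
def HCross (K : Set (ℝ × ℝ)) (i j : ℝ) : Prop :=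
  (∃ p ∈ K, p.2 < j) ∧ (∃ p ∈ K, j < p.2) ∧ ∃ t, i < t ∧ t < i + 1 ∧ (t, j) ∈ K

/-- `K` has points on both sides of the line `x₁ = i` and meets it between `x₂ = j` and
`x₂ = j + 1`. -/
def VCross (K : Set (ℝ × ℝ)) (i j : ℝ) : Prop :=
  (∃ p ∈ K, p.1 < i) ∧ (∃ p ∈ K, i < p.1) ∧ ∃ t, j < t ∧ t < j + 1 ∧ (i, t) ∈ K

/-- The six types for the lattice `ℤ²`, in terms of crossed lattice segments. -/
inductive UnitType (K : Set (ℝ × ℝ)) : Prop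
  | one (h : ∀ p ∈ K, 0 ≤ p.1 ∧ p.1 ≤ 1)
  | two (hb : HCross K 0 0) (hr : VCross K 1 0) (ht : HCross K 0 1) (hl : VCross K 0 0)
  | three (hb : HCross K 0 0) (hr : VCross K 1 0) (ht : HCross K 0 1) (hl : ∀ p ∈ K, 0 ≤ p.1)
  | four (hl : VCross K 0 0) (hb : HCross K 0 0) (hr : VCross K 1 0) (ht : HCross K 1 1)
      (h : ∀ p ∈ K, -1 < p.1 ∧ p.1 < 2)
  | five (hb : HCross K (-1) 0) (hr : VCross K 0 0) (h : ∀ p ∈ K, -1 ≤ p.1 ∧ p.2 ≤ 1)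
  | six (hb : HCross K (-1) 0) (hr : VCross K 0 0) (ht : HCross K 0 1)
      (h : ∀ p ∈ K, -1 ≤ p.1 ∧ p.1 ≤ 1)

/-- `K` is of one of the six types up to a unimodular map. -/
def Classified (K : Set (ℝ × ℝ)) : Prop := ∃ g : UnimodularMap, UnitType (g.pre K)

lemma Classified.of_pre {K : Set (ℝ × ℝ)} (g : UnimodularMap) (h : Classified (g.pre K)) :
    Classified K := by
  obtain ⟨k, hk⟩ := h
  exact ⟨g.comp k, by rwa [UnimodularMap.pre_comp]⟩

lemma UnitType.classified {K : Set (ℝ × ℝ)} (h : UnitType K) : Classified K := by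
  refine ⟨⟨1, 0, 0, 1, 0, 0, by simp⟩, ?_⟩
  have : (⟨1, 0, 0, 1, 0, 0, by simp⟩ : UnimodularMap).pre K = K := by
    ext p
    simp [UnimodularMap.pre, UnimodularMap.toFun]
  rwa [this]

/-! ### Sections of a free body by lattice lines -/

namespace IsFreeBody

variable {K : Set (ℝ × ℝ)}

lemma vert_mem (hK : IsFreeBody K) {p q : ℝ × ℝ} (hp : p ∈ K) (hq : q ∈ K) {k : ℝ}
    (h1 : p.1 ≤ k) (h2 : k ≤ q.1) (h : p.1 < q.1) :
    (k, (p.2 * (q.1 - k) + q.2 * (k - p.1)) / (q.1 - p.1)) ∈ K := by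
  have h0 : 0 < q.1 - p.1 := sub_pos.2 h
  have := hK.convex hp hq (a := (q.1 - k) / (q.1 - p.1)) (b := (k - p.1) / (q.1 - p.1))
    (div_nonneg (sub_nonneg.2 h2) h0.le) (div_nonneg (sub_nonneg.2 h1) h0.le)
    (by field_simp; ring)
  convert this using 1
  ext
  · simp only [Prod.fst_add, Prod.smul_fst, smul_eq_mul]
    field_simp
    ring
  · simp only [Prod.snd_add, Prod.smul_snd, smul_eq_mul]
    field_simp

lemma horiz_mem (hK : IsFreeBody K) {p q : ℝ × ℝ} (hp : p ∈ K) (hq : q ∈ K) {k : ℝ}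
    (h1 : p.2 ≤ k) (h2 : k ≤ q.2) (h : p.2 < q.2) :
    ((p.1 * (q.2 - k) + q.1 * (k - p.2)) / (q.2 - p.2), k) ∈ K :=
  UnimodularMap.mem_swap.1 <|
    (hK.pre UnimodularMap.swap).vert_mem (p := (p.2, p.1)) (q := (q.2, q.1))
      (UnimodularMap.mem_swap.2 hp) (UnimodularMap.mem_swap.2 hq) h1 h2 h

/-- The section by a lattice line is an interval containing no integer, so it cannot leave the gap
of any one of its points. -/
lemma vert_unique (hK : IsFreeBody K) (k a : ℤ) {y y' : ℝ} (hy : ((k : ℝ), y) ∈ K)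
    (hy' : ((k : ℝ), y') ∈ K) (h0 : a < y) (h1 : y < a + 1) : a < y' ∧ y' < a + 1 := by
  have seg : ∀ z : ℝ, (y ≤ z ∧ z ≤ y' ∨ y' ≤ z ∧ z ≤ y) → ((k : ℝ), z) ∈ K := by
    intro z hz
    have hc : Convex ℝ {t : ℝ | ((k : ℝ), t) ∈ K} := by
      intro s hs t ht α β hα hβ hαβ
      have := hK.convex hs ht hα hβ hαβ
      simpa [← add_mul, hαβ] using this
    have := hc.ordConnected
    rcases hz with hz | hz
    · exact this.out hy hy' hz
    · exact this.out hy' hy hz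
  constructor
  · by_contra! h
    exact hK.free k a (seg a (Or.inr ⟨h, h0.le⟩))
  · by_contra! h
    exact hK.free k (a + 1) (by push_cast; exact seg (a + 1) (Or.inl ⟨h1.le, h⟩))

/-- The gap condition for the crossing point of a chord, cleared of denominators: this is how one
known crossing constrains every pair of points in later arguments. -/
lemma vert_bounds (hK : IsFreeBody K) (k a : ℤ) {y : ℝ} (hy : ((k : ℝ), y) ∈ K)
    (h0 : a < y) (h1 : y < a + 1) {p q : ℝ × ℝ} (hp : p ∈ K) (hq : q ∈ K)
    (hpk : p.1 ≤ k) (hkq : k ≤ q.1) (h : p.1 < q.1) :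
    a * (q.1 - p.1) < p.2 * (q.1 - k) + q.2 * (k - p.1) ∧
      p.2 * (q.1 - k) + q.2 * (k - p.1) < (a + 1) * (q.1 - p.1) := by
  have := hK.vert_unique k a hy (hK.vert_mem hp hq hpk hkq h) h0 h1
  rwa [lt_div_iff₀ (sub_pos.2 h), div_lt_iff₀ (sub_pos.2 h)] at this

lemma horiz_unique (hK : IsFreeBody K) (k a : ℤ) {y y' : ℝ} (hy : (y, (k : ℝ)) ∈ K)
    (hy' : (y', (k : ℝ)) ∈ K) (h0 : a < y) (h1 : y < a + 1) : a < y' ∧ y' < a + 1 :=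
  (hK.pre UnimodularMap.swap).vert_unique k a (UnimodularMap.mem_swap.2 hy)
    (UnimodularMap.mem_swap.2 hy') h0 h1

lemma horiz_bounds (hK : IsFreeBody K) (k a : ℤ) {y : ℝ} (hy : (y, (k : ℝ)) ∈ K)
    (h0 : a < y) (h1 : y < a + 1) {p q : ℝ × ℝ} (hp : p ∈ K) (hq : q ∈ K)
    (hpk : p.2 ≤ k) (hkq : k ≤ q.2) (h : p.2 < q.2) :
    a * (q.2 - p.2) < p.1 * (q.2 - k) + q.1 * (k - p.2) ∧
      p.1 * (q.2 - k) + q.1 * (k - p.2) < (a + 1) * (q.2 - p.2) := by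
  have := hK.horiz_unique k a hy (hK.horiz_mem hp hq hpk hkq h) h0 h1
  rwa [lt_div_iff₀ (sub_pos.2 h), div_lt_iff₀ (sub_pos.2 h)] at this

lemma exists_floor_vert (hK : IsFreeBody K) (k : ℤ) {y : ℝ} (hy : ((k : ℝ), y) ∈ K) :
    ∃ a : ℤ, (a : ℝ) < y ∧ y < a + 1 := by
  refine ⟨⌊y⌋, lt_of_le_of_ne (Int.floor_le y) ?_, Int.lt_floor_add_one y⟩
  intro h
  rw [← h] at hy
  exact hK.free _ _ hy

lemma exists_floor_horiz (hK : IsFreeBody K) (k : ℤ) {y : ℝ} (hy : (y, (k : ℝ)) ∈ K) :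
    ∃ a : ℤ, (a : ℝ) < y ∧ y < a + 1 :=
  (hK.pre UnimodularMap.swap).exists_floor_vert k (UnimodularMap.mem_swap.2 hy)

/-- Non-strict bounds suffice, because the endpoints of the edge are lattice points and hence not in
`K`. -/
lemma hcross_of_le (hK : IsFreeBody K) (i j : ℤ) {p q : ℝ × ℝ} (hp : p ∈ K) (hq : q ∈ K)
    (h1 : p.2 < j) (h2 : j < q.2) (hi : i * (q.2 - p.2) ≤ p.1 * (q.2 - j) + q.1 * (j - p.2))
    (hi' : p.1 * (q.2 - j) + q.1 * (j - p.2) ≤ (i + 1) * (q.2 - p.2)) : HCross K i j := by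
  have h0 : 0 < q.2 - p.2 := by linarith
  have hm := hK.horiz_mem hp hq h1.le h2.le (h1.trans h2)
  refine ⟨⟨p, hp, h1⟩, ⟨q, hq, h2⟩, _, ?_, ?_, hm⟩
  · refine lt_of_le_of_ne ((le_div_iff₀ h0).2 hi) fun h => ?_
    rw [← h] at hm
    exact hK.free i j hm
  · refine lt_of_le_of_ne ((div_le_iff₀ h0).2 hi') fun h => ?_
    rw [h] at hm
    exact hK.free (i + 1) j (by push_cast; exact hm)

lemma vcross_of_le (hK : IsFreeBody K) (i j : ℤ) {p q : ℝ × ℝ} (hp : p ∈ K) (hq : q ∈ K)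
    (h1 : p.1 < i) (h2 : i < q.1) (hj : j * (q.1 - p.1) ≤ p.2 * (q.1 - i) + q.2 * (i - p.1))
    (hj' : p.2 * (q.1 - i) + q.2 * (i - p.1) ≤ (j + 1) * (q.1 - p.1)) : VCross K i j := by
  have h0 : 0 < q.1 - p.1 := by linarith
  have hm := hK.vert_mem hp hq h1.le h2.le (h1.trans h2)
  refine ⟨⟨p, hp, h1⟩, ⟨q, hq, h2⟩, _, ?_, ?_, hm⟩
  · refine lt_of_le_of_ne ((le_div_iff₀ h0).2 hj) fun h => ?_
    rw [← h] at hm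
    exact hK.free i j hm
  · refine lt_of_le_of_ne ((div_le_iff₀ h0).2 hj') fun h => ?_
    rw [h] at hm
    exact hK.free i (j + 1) (by push_cast; exact hm)

end IsFreeBody

namespace UnimodularMap

variable {K : Set (ℝ × ℝ)}

/-- The reflection `(x, y) ↦ (-x, y)`. -/
def mirrorX : UnimodularMap := ⟨-1, 0, 0, 1, 0, 0, by simp⟩

/-- The reflection `(x, y) ↦ (x, 1 - y)`. -/
def mirrorY : UnimodularMap := ⟨1, 0, 0, -1, 0, 1, by simp⟩

/-- The shear `(x, y) ↦ (x, k x + y)`. -/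
def shear (k : ℤ) : UnimodularMap := ⟨1, 0, k, 1, 0, 0, by simp⟩

/-- The translation by `(u, v)`. -/
def translation (u v : ℤ) : UnimodularMap := ⟨1, 0, 0, 1, u, v, by simp⟩

lemma mem_pre (g : UnimodularMap) (p : ℝ × ℝ) : p ∈ g.pre K ↔
    ((g.a * p.1 + g.b * p.2 + g.e : ℝ), (g.c * p.1 + g.d * p.2 + g.f : ℝ)) ∈ K := Iff.rfl

lemma mem_mirrorX (p : ℝ × ℝ) : p ∈ mirrorX.pre K ↔ (-p.1, p.2) ∈ K := by
  simp [mem_pre, mirrorX]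

lemma mem_mirrorY (p : ℝ × ℝ) : p ∈ mirrorY.pre K ↔ (p.1, 1 - p.2) ∈ K := by
  simp [mem_pre, mirrorY, sub_eq_neg_add]

lemma mem_shear (k : ℤ) (p : ℝ × ℝ) : p ∈ (shear k).pre K ↔ (p.1, k * p.1 + p.2) ∈ K := by
  simp [mem_pre, shear]

lemma mem_translation (u v : ℤ) (p : ℝ × ℝ) :
    p ∈ (translation u v).pre K ↔ (p.1 + u, p.2 + v) ∈ K := by
  simp [mem_pre, translation]

end UnimodularMap

open UnimodularMap

/-! ### Slabs of width two -/

/-- A free body in the slab `-1 ≤ x₁ ≤ 1` that has points on both sides of the line `x₁ = 0` and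
meets it between `x₂ = 0` and `x₂ = 1`. -/
structure IsCentral (K : Set (ℝ × ℝ)) : Prop where
  body : IsFreeBody K
  slab : ∀ p ∈ K, -1 ≤ p.1 ∧ p.1 ≤ 1
  cross : VCross K 0 0

/-- `K` has a point in the open quadrant `x₁ < 0`, `x₂ < 0`. -/
def LeftBelow (K : Set (ℝ × ℝ)) : Prop := ∃ p ∈ K, p.1 < 0 ∧ p.2 < 0

/-- `K` has a point in the open quadrant `x₁ > 0`, `x₂ < 0`. -/
def RightBelow (K : Set (ℝ × ℝ)) : Prop := ∃ p ∈ K, 0 < p.1 ∧ p.2 < 0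

/-- `K` has a point in the open quadrant `x₁ < 0`, `x₂ > 1`. -/
def LeftAbove (K : Set (ℝ × ℝ)) : Prop := ∃ p ∈ K, p.1 < 0 ∧ 1 < p.2

/-- `K` has a point in the open quadrant `x₁ > 0`, `x₂ > 1`. -/
def RightAbove (K : Set (ℝ × ℝ)) : Prop := ∃ p ∈ K, 0 < p.1 ∧ 1 < p.2

section Quadrants

variable {K : Set (ℝ × ℝ)}

lemma leftBelow_mirrorX : LeftBelow (mirrorX.pre K) ↔ RightBelow K := by
  constructor
  · rintro ⟨p, hp, h1, h2⟩
    exact ⟨_, (mem_mirrorX p).1 hp, neg_pos.2 h1, h2⟩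
  · rintro ⟨p, hp, h1, h2⟩
    exact ⟨(-p.1, p.2), (mem_mirrorX _).2 (by simpa using hp), neg_lt_zero.2 h1, h2⟩

lemma rightBelow_mirrorX : RightBelow (mirrorX.pre K) ↔ LeftBelow K := by
  constructor
  · rintro ⟨p, hp, h1, h2⟩
    exact ⟨_, (mem_mirrorX p).1 hp, neg_lt_zero.2 h1, h2⟩
  · rintro ⟨p, hp, h1, h2⟩
    exact ⟨(-p.1, p.2), (mem_mirrorX _).2 (by simpa using hp), neg_pos.2 h1, h2⟩

lemma leftAbove_mirrorX : LeftAbove (mirrorX.pre K) ↔ RightAbove K := by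
  constructor
  · rintro ⟨p, hp, h1, h2⟩
    exact ⟨_, (mem_mirrorX p).1 hp, neg_pos.2 h1, h2⟩
  · rintro ⟨p, hp, h1, h2⟩
    exact ⟨(-p.1, p.2), (mem_mirrorX _).2 (by simpa using hp), neg_lt_zero.2 h1, h2⟩

lemma rightAbove_mirrorX : RightAbove (mirrorX.pre K) ↔ LeftAbove K := by
  constructor
  · rintro ⟨p, hp, h1, h2⟩
    exact ⟨_, (mem_mirrorX p).1 hp, neg_lt_zero.2 h1, h2⟩
  · rintro ⟨p, hp, h1, h2⟩
    exact ⟨(-p.1, p.2), (mem_mirrorX _).2 (by simpa using hp), neg_pos.2 h1, h2⟩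

lemma leftBelow_mirrorY : LeftBelow (mirrorY.pre K) ↔ LeftAbove K := by
  constructor
  · rintro ⟨p, hp, h1, h2⟩
    exact ⟨_, (mem_mirrorY p).1 hp, h1, by linarith⟩
  · rintro ⟨p, hp, h1, h2⟩
    exact ⟨(p.1, 1 - p.2), (mem_mirrorY _).2 (by simpa using hp), h1, by simpa using h2⟩

lemma rightBelow_mirrorY : RightBelow (mirrorY.pre K) ↔ RightAbove K := by
  constructor
  · rintro ⟨p, hp, h1, h2⟩
    exact ⟨_, (mem_mirrorY p).1 hp, h1, by linarith⟩
  · rintro ⟨p, hp, h1, h2⟩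
    exact ⟨(p.1, 1 - p.2), (mem_mirrorY _).2 (by simpa using hp), h1, by simpa using h2⟩

lemma leftAbove_mirrorY : LeftAbove (mirrorY.pre K) ↔ LeftBelow K := by
  constructor
  · rintro ⟨p, hp, h1, h2⟩
    exact ⟨_, (mem_mirrorY p).1 hp, h1, by simpa using h2⟩
  · rintro ⟨p, hp, h1, h2⟩
    exact ⟨(p.1, 1 - p.2), (mem_mirrorY _).2 (by simpa using hp), h1, by linarith⟩

lemma rightAbove_mirrorY : RightAbove (mirrorY.pre K) ↔ RightBelow K := by
  constructor
  · rintro ⟨p, hp, h1, h2⟩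
    exact ⟨_, (mem_mirrorY p).1 hp, h1, by simpa using h2⟩
  · rintro ⟨p, hp, h1, h2⟩
    exact ⟨(p.1, 1 - p.2), (mem_mirrorY _).2 (by simpa using hp), h1, by linarith⟩

end Quadrants

namespace IsCentral

variable {K : Set (ℝ × ℝ)}

lemma mirrorX (h : IsCentral K) : IsCentral (mirrorX.pre K) where
  body := h.body.pre _
  slab p hp := by
    have := h.slab _ ((mem_mirrorX p).1 hp)
    simp only at this
    constructor <;> linarith
  cross := by
    obtain ⟨⟨p, hp, h1⟩, ⟨q, hq, h2⟩, t, ht0, ht1, ht⟩ := h.cross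
    exact ⟨⟨(-q.1, q.2), (mem_mirrorX _).2 (by simpa using hq), by simpa using h2⟩,
      ⟨(-p.1, p.2), (mem_mirrorX _).2 (by simpa using hp), by simpa using h1⟩,
      t, ht0, ht1, (mem_mirrorX _).2 (by simpa using ht)⟩

lemma mirrorY (h : IsCentral K) : IsCentral (mirrorY.pre K) where
  body := h.body.pre _
  slab p hp := (h.slab _ ((mem_mirrorY p).1 hp) :)
  cross := by
    obtain ⟨⟨p, hp, h1⟩, ⟨q, hq, h2⟩, t, ht0, ht1, ht⟩ := h.cross
    exact ⟨⟨(p.1, 1 - p.2), (mem_mirrorY _).2 (by simpa using hp), by simpa using h1⟩,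
      ⟨(q.1, 1 - q.2), (mem_mirrorY _).2 (by simpa using hq), by simpa using h2⟩,
      1 - t, by linarith, by linarith, (mem_mirrorY _).2 (by simpa using ht)⟩

lemma shear (h : IsCentral K) (k : ℤ) : IsCentral ((shear k).pre K) where
  body := h.body.pre _
  slab p hp := (h.slab _ ((mem_shear k p).1 hp) :)
  cross := by
    obtain ⟨⟨p, hp, h1⟩, ⟨q, hq, h2⟩, t, ht0, ht1, ht⟩ := h.cross
    exact ⟨⟨(p.1, p.2 - k * p.1), (mem_shear k _).2 (by simpa using hp), h1⟩,
      ⟨(q.1, q.2 - k * q.1), (mem_shear k _).2 (by simpa using hq), h2⟩,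
      t, ht0, ht1, (mem_shear k _).2 (by simpa using ht)⟩

lemma bounds (h : IsCentral K) {p q : ℝ × ℝ} (hp : p ∈ K) (hq : q ∈ K) (h1 : p.1 ≤ 0)
    (h2 : 0 ≤ q.1) (hpq : p.1 < q.1) :
    0 < p.2 * q.1 - q.2 * p.1 ∧ p.2 * q.1 - q.2 * p.1 < q.1 - p.1 := by
  obtain ⟨-, -, t, ht0, ht1, ht⟩ := h.cross
  have := h.body.vert_bounds 0 0 (by simpa using ht) (by simpa using ht0) (by simpa using ht1)
    hp hq (by simpa using h1) (by simpa using h2) hpq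
  push_cast at this
  constructor <;> nlinarith

/-- A chord between the two quadrants would meet `x₁ = 0` below the gap `(0, 1)`. -/
lemma not_leftBelow_rightBelow (h : IsCentral K) : ¬ (LeftBelow K ∧ RightBelow K) := by
  rintro ⟨⟨p, hp, hp1, hp2⟩, q, hq, hq1, hq2⟩
  have := (h.bounds hp hq hp1.le hq1.le (hp1.trans hq1)).1
  nlinarith

lemma not_leftAbove_rightAbove (h : IsCentral K) : ¬ (LeftAbove K ∧ RightAbove K) := by
  have := h.mirrorY.not_leftBelow_rightBelow
  rwa [leftBelow_mirrorY, rightBelow_mirrorY] at this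

/-- Chords from the two left points to the crossing on `x₁ = 0` cut the bottom and top edges of the
square `[-1, 0] × [0, 1]`; the slab bound at `x₁ = -1` completes type III. -/
lemma classified_of_left (h : IsCentral K) (h1 : LeftBelow K) (h2 : LeftAbove K) :
    Classified K := by
  obtain ⟨p, hp, hp1, hp2⟩ := h1
  obtain ⟨q, hq, hq1, hq2⟩ := h2
  obtain ⟨hl, ⟨r, hr, hr1⟩, t, ht0, ht1, ht⟩ := h.cross
  have hp3 := (h.slab p hp).1
  have hq3 := (h.slab q hq).1
  refine Classified.of_pre (translation (-1) 0) (UnitType.classified (.three ?_ ?_ ?_ ?_))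
  · have := (h.body.pre (translation (-1) 0)).hcross_of_le 0 0 (p := (p.1 + 1, p.2)) (q := (1, t))
      ((mem_translation _ _ _).2 (by simpa using hp)) ((mem_translation _ _ _).2 (by simpa using ht))
      (by simpa using hp2) (by simpa using ht0)
      (by push_cast; nlinarith) (by push_cast; nlinarith)
    simpa using this
  · refine ⟨⟨(p.1 + 1, p.2), (mem_translation _ _ _).2 (by simpa using hp), by simpa using hp1⟩,
      ⟨(r.1 + 1, r.2), (mem_translation _ _ _).2 (by simpa using hr), by simpa using hr1⟩,
      t, ht0, by linarith, (mem_translation _ _ _).2 (by simpa using ht)⟩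
  · have := (h.body.pre (translation (-1) 0)).hcross_of_le 0 1 (p := (1, t)) (q := (q.1 + 1, q.2))
      ((mem_translation _ _ _).2 (by simpa using ht)) ((mem_translation _ _ _).2 (by simpa using hq))
      (by push_cast; linarith) (by push_cast; linarith)
      (by push_cast; nlinarith) (by push_cast; nlinarith)
    simpa using this
  · intro p hp
    have := (h.slab _ ((mem_translation _ _ p).1 hp)).1
    push_cast at this
    linarith

lemma le_one (h : IsCentral K) (h1 : ¬ LeftAbove K) (h2 : ¬ RightAbove K) {p : ℝ × ℝ}
    (hp : p ∈ K) : p.2 ≤ 1 := by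
  by_contra! hlt
  rcases lt_trichotomy p.1 0 with h0 | h0 | h0
  · exact h1 ⟨p, hp, h0, hlt⟩
  · obtain ⟨-, ⟨q, hq, hq1⟩, -⟩ := h.cross
    have := (h.bounds hp hq h0.le hq1.le (by linarith)).2
    rw [h0] at this
    nlinarith
  · exact h2 ⟨p, hp, h0, hlt⟩

lemma nonneg (h : IsCentral K) (h1 : ¬ LeftBelow K) (h2 : ¬ RightBelow K) {p : ℝ × ℝ}
    (hp : p ∈ K) : 0 ≤ p.2 := by
  have := h.mirrorY.le_one (p := (p.1, 1 - p.2)) (by rwa [leftAbove_mirrorY])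
    (by rwa [rightAbove_mirrorY]) ((mem_mirrorY _).2 (by simpa using hp))
  simpa using this

lemma classified_of_none (h : IsCentral K) (h1 : ¬ LeftBelow K) (h2 : ¬ RightBelow K)
    (h3 : ¬ LeftAbove K) (h4 : ¬ RightAbove K) : Classified K := by
  refine .of_pre swap (UnitType.classified (.one fun p hp => ?_))
  exact ⟨h.nonneg h1 h2 (mem_swap.1 hp), h.le_one h3 h4 (mem_swap.1 hp)⟩

lemma hcross_of_leftBelow (h : IsCentral K) (h1 : LeftBelow K) : HCross K (-1) 0 := by
  obtain ⟨p, hp, hp1, hp2⟩ := h1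
  obtain ⟨-, -, t, ht0, ht1, ht⟩ := h.cross
  have hp3 := (h.slab p hp).1
  have := h.body.hcross_of_le (-1) 0 hp ht (by simpa using hp2) (by simpa using ht0)
      (by push_cast; nlinarith) (by push_cast; nlinarith)
  simpa using this

lemma classified_of_leftBelow (h : IsCentral K) (h1 : LeftBelow K) (h2 : ¬ LeftAbove K)
    (h3 : ¬ RightAbove K) : Classified K :=
  UnitType.classified (.five (h.hcross_of_leftBelow h1) h.cross
    fun _ hp => ⟨(h.slab _ hp).1, h.le_one h2 h3 hp⟩)

lemma classified_of_rightBelow (h : IsCentral K) (h1 : RightBelow K) (h2 : ¬ LeftAbove K)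
    (h3 : ¬ RightAbove K) : Classified K :=
  .of_pre _ (h.mirrorX.classified_of_leftBelow (leftBelow_mirrorX.2 h1)
    (by rwa [leftAbove_mirrorX]) (by rwa [rightAbove_mirrorX]))

/-- At most one quadrant below and one above can be occupied unless a side repeats, and every
pattern without a right-below point is settled by reflections except the diagonal left-below,
right-above one. -/
lemma classified_or (h : IsCentral K) : Classified K ∨
    (LeftBelow K ∧ RightAbove K ∧ ¬ RightBelow K) ∨ RightBelow K := by
  by_cases h1 : RightBelow K
  · exact Or.inr (Or.inr h1)
  by_cases h2 : RightAbove K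
  · by_cases h3 : LeftBelow K
    · exact Or.inr (Or.inl ⟨h3, h2, h1⟩)
    · have h4 : ¬ LeftAbove K := fun h4 => h.not_leftAbove_rightAbove ⟨h4, h2⟩
      exact Or.inl (.of_pre _ (h.mirrorY.classified_of_rightBelow (rightBelow_mirrorY.2 h2)
        (by rwa [leftAbove_mirrorY]) (by rwa [rightAbove_mirrorY])))
  · left
    by_cases h3 : LeftBelow K
    · by_cases h4 : LeftAbove K
      · exact h.classified_of_left h3 h4
      · exact h.classified_of_leftBelow h3 h4 h2
    · by_cases h4 : LeftAbove K
      · exact .of_pre _ (h.mirrorY.classified_of_leftBelow (leftBelow_mirrorY.2 h4)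
          (by rwa [leftAbove_mirrorY]) (by rwa [rightAbove_mirrorY]))
      · exact h.classified_of_none h3 h1 h4 h2

lemma classified_or' (h : IsCentral K) : Classified K ∨ LeftBelow K ∨
    (RightBelow K ∧ LeftAbove K ∧ ¬ LeftBelow K) := by
  rcases h.mirrorX.classified_or with h1 | h1 | h1
  · exact Or.inl (.of_pre _ h1)
  · rw [leftBelow_mirrorX, rightAbove_mirrorX, rightBelow_mirrorX] at h1
    exact Or.inr (Or.inr h1)
  · rw [rightBelow_mirrorX] at h1
    exact Or.inr (Or.inl h1)

/-- Shears fix the line `x₁ = 0` and tilt the two sides in opposite directions. Just before the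
shear parameter at which a right-below point first appears, the only unsettled pattern is left-below
with right-above, and that pattern is type VI. -/
theorem classified (h : IsCentral K) : Classified K := by
  by_contra hc
  obtain ⟨⟨p, hp, hp1⟩, ⟨q, hq, hq1⟩, -⟩ := id h.cross
  have hex : ∃ k : ℤ, RightBelow ((UnimodularMap.shear k).pre K) := by
    obtain ⟨k, hk⟩ := exists_int_gt (q.2 / q.1)
    rw [div_lt_iff₀ hq1] at hk
    exact ⟨k, (q.1, q.2 - k * q.1), (mem_shear k _).2 (by simpa using hq), hq1, by simpa using hk⟩
  -- For `k < p.2 / p.1` the sheared left point lies below, which excludes a right-below point.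
  have hbd : ∀ k : ℤ, RightBelow ((UnimodularMap.shear k).pre K) → ⌊p.2 / p.1⌋ ≤ k := by
    intro k hk
    by_contra! hlt
    refine (h.shear k).not_leftBelow_rightBelow ⟨⟨(p.1, p.2 - k * p.1),
      (mem_shear k _).2 (by simpa using hp), hp1, ?_⟩, hk⟩
    have : (k : ℝ) < p.2 / p.1 := (Int.cast_lt.2 hlt).trans_le (Int.floor_le _)
    rw [lt_div_iff_of_neg hp1] at this
    simpa using this
  obtain ⟨k, hk, hmin⟩ := Int.exists_least_of_bdd ⟨_, hbd⟩ hex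
  have hprev : ¬ RightBelow ((UnimodularMap.shear (k - 1)).pre K) := fun hr => by
    have := hmin _ hr
    omega
  have hc' : ∀ j : ℤ, ¬ Classified ((UnimodularMap.shear j).pre K) := fun j hj => hc (.of_pre _ hj)
  have h1 : LeftAbove ((UnimodularMap.shear k).pre K) := by
    rcases (h.shear k).classified_or' with h1 | h1 | h1
    · exact absurd h1 (hc' k)
    · exact absurd ⟨h1, hk⟩ (h.shear k).not_leftBelow_rightBelow
    · exact h1.2.1
  have h2 : LeftBelow ((UnimodularMap.shear (k - 1)).pre K) ∧
      RightAbove ((UnimodularMap.shear (k - 1)).pre K) := by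
    rcases (h.shear (k - 1)).classified_or with h1 | h1 | h1
    · exact absurd h1 (hc' _)
    · exact ⟨h1.1, h1.2.1⟩
    · exact absurd h1 hprev
  have hC := h.shear (k - 1)
  obtain ⟨r, hr, hr1, hr2⟩ := h2.2
  obtain ⟨-, -, t, ht0, ht1, ht⟩ := hC.cross
  have hr3 := (hC.slab r hr).2
  refine hc' (k - 1) (UnitType.classified (.six (hC.hcross_of_leftBelow h2.1) hC.cross ?_ hC.slab))
  have := hC.body.hcross_of_le 0 1 ht hr (by push_cast; linarith) (by push_cast; linarith)
      (by push_cast; nlinarith) (by push_cast; nlinarith)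
  simpa using this

end IsCentral

/-- A free body in the slab `-1 ≤ x₁ ≤ 1` is classified. -/
theorem IsFreeBody.classified_of_slab_two {K : Set (ℝ × ℝ)} (hK : IsFreeBody K)
    (hs : ∀ p ∈ K, -1 ≤ p.1 ∧ p.1 ≤ 1) : Classified K := by
  by_cases h1 : ∃ p ∈ K, p.1 < 0
  · by_cases h2 : ∃ p ∈ K, 0 < p.1
    · obtain ⟨p, hp, hp1⟩ := h1
      obtain ⟨q, hq, hq1⟩ := h2
      have hm := hK.vert_mem hp hq hp1.le hq1.le (hp1.trans hq1)
      set t := (p.2 * (q.1 - 0) + q.2 * (0 - p.1)) / (q.1 - p.1)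
      obtain ⟨a, ha, ha'⟩ := hK.exists_floor_vert 0 (by simpa using hm)
      refine .of_pre (translation 0 a) (IsCentral.classified ⟨hK.pre _, fun p hp => ?_, ?_⟩)
      · have := hs _ ((mem_translation _ _ p).1 hp)
        simpa using this
      · exact ⟨⟨(p.1, p.2 - a), (mem_translation _ _ _).2 (by simpa using hp), hp1⟩,
          ⟨(q.1, q.2 - a), (mem_translation _ _ _).2 (by simpa using hq), hq1⟩,
          t - a, by linarith, by linarith, (mem_translation _ _ _).2 (by simpa using hm)⟩
    · push Not at h2
      refine .of_pre (translation (-1) 0) (UnitType.classified (.one fun p hp => ?_))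
      have h3 := h2 _ ((mem_translation _ _ p).1 hp)
      have h4 := hs _ ((mem_translation _ _ p).1 hp)
      push_cast at h3 h4
      constructor <;> linarith
  · push Not at h1
    exact UnitType.classified (.one fun p hp => ⟨h1 p hp, (hs p hp).2⟩)

/-! ### Open slabs of width three -/

/-- The reflection `(x, y) ↦ (1 - x, y)`. -/
def UnimodularMap.mirrorC : UnimodularMap := ⟨-1, 0, 0, 1, 1, 0, by simp⟩

lemma UnimodularMap.mem_mirrorC {K : Set (ℝ × ℝ)} (p : ℝ × ℝ) :
    p ∈ mirrorC.pre K ↔ (1 - p.1, p.2) ∈ K := by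
  simp [mem_pre, mirrorC, sub_eq_neg_add]

/-- A free body in the open slab `-1 < x₁ < 2` that crosses the left and the right edge of the
unit square. -/
structure IsWide (K : Set (ℝ × ℝ)) : Prop where
  body : IsFreeBody K
  slab : ∀ p ∈ K, -1 < p.1 ∧ p.1 < 2
  left : VCross K 0 0
  right : VCross K 1 0

lemma HCross.mirrorC {K : Set (ℝ × ℝ)} {i j : ℝ} (h : HCross K i j) :
    HCross (mirrorC.pre K) (-i) j := by
  obtain ⟨⟨p, hp, h1⟩, ⟨q, hq, h2⟩, t, ht0, ht1, ht⟩ := h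
  exact ⟨⟨(1 - p.1, p.2), (mem_mirrorC _).2 (by simpa using hp), h1⟩,
    ⟨(1 - q.1, q.2), (mem_mirrorC _).2 (by simpa using hq), h2⟩,
    1 - t, by linarith, by linarith, (mem_mirrorC _).2 (by simpa using ht)⟩

lemma HCross.mirrorY {K : Set (ℝ × ℝ)} {i j : ℝ} (h : HCross K i j) :
    HCross (mirrorY.pre K) i (1 - j) := by
  obtain ⟨⟨p, hp, h1⟩, ⟨q, hq, h2⟩, t, ht0, ht1, ht⟩ := h
  exact ⟨⟨(q.1, 1 - q.2), (mem_mirrorY _).2 (by simpa using hq), by simpa using h2⟩,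
    ⟨(p.1, 1 - p.2), (mem_mirrorY _).2 (by simpa using hp), by simpa using h1⟩,
    t, by linarith, by linarith, (mem_mirrorY _).2 (by simpa using ht)⟩

lemma VCross.mirrorC {K : Set (ℝ × ℝ)} {i j : ℝ} (h : VCross K i j) :
    VCross (mirrorC.pre K) (1 - i) j := by
  obtain ⟨⟨p, hp, h1⟩, ⟨q, hq, h2⟩, t, ht0, ht1, ht⟩ := h
  exact ⟨⟨(1 - q.1, q.2), (mem_mirrorC _).2 (by simpa using hq), by simpa using h2⟩,
    ⟨(1 - p.1, p.2), (mem_mirrorC _).2 (by simpa using hp), by simpa using h1⟩,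
    t, by linarith, by linarith, (mem_mirrorC _).2 (by simpa using ht)⟩

lemma VCross.mirrorY {K : Set (ℝ × ℝ)} {i j : ℝ} (h : VCross K i j) :
    VCross (mirrorY.pre K) i (-j) := by
  obtain ⟨⟨p, hp, h1⟩, ⟨q, hq, h2⟩, t, ht0, ht1, ht⟩ := h
  exact ⟨⟨(p.1, 1 - p.2), (mem_mirrorY _).2 (by simpa using hp), h1⟩,
    ⟨(q.1, 1 - q.2), (mem_mirrorY _).2 (by simpa using hq), h2⟩,
    1 - t, by linarith, by linarith, (mem_mirrorY _).2 (by simpa using ht)⟩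

namespace IsWide

variable {K : Set (ℝ × ℝ)}

lemma mirrorC (h : IsWide K) : IsWide (mirrorC.pre K) where
  body := h.body.pre _
  slab p hp := by
    have := h.slab _ ((mem_mirrorC p).1 hp)
    simp only at this
    constructor <;> linarith
  left := by simpa using h.right.mirrorC
  right := by simpa using h.left.mirrorC

lemma mirrorY (h : IsWide K) : IsWide (mirrorY.pre K) where
  body := h.body.pre _
  slab p hp := (h.slab _ ((mem_mirrorY p).1 hp) :)
  left := by simpa using h.left.mirrorY
  right := by simpa using h.right.mirrorY

lemma bounds_right (h : IsWide K) {p q : ℝ × ℝ} (hp : p ∈ K) (hq : q ∈ K) (h1 : p.1 ≤ 1)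
    (h2 : 1 ≤ q.1) (hpq : p.1 < q.1) :
    0 < p.2 * (q.1 - 1) + q.2 * (1 - p.1) ∧
      p.2 * (q.1 - 1) + q.2 * (1 - p.1) < q.1 - p.1 := by
  obtain ⟨-, -, t, ht0, ht1, ht⟩ := h.right
  have := h.body.vert_bounds 1 0 (by simpa using ht) (by simpa using ht0) (by simpa using ht1)
    hp hq (by simpa using h1) (by simpa using h2) hpq
  push_cast at this
  constructor <;> linarith

/-- The slab leaves only three unit gaps of `x₂ = 0` available for a crossing. -/
lemma bottom_cases (h : IsWide K) :
    (∀ p ∈ K, 0 ≤ p.2) ∨ HCross K (-1) 0 ∨ HCross K 0 0 ∨ HCross K 1 0 := by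
  by_cases hp : ∃ p ∈ K, p.2 < 0
  · right
    obtain ⟨p, hp, hp2⟩ := hp
    obtain ⟨-, -, c, hc0, hc1, hc⟩ := h.left
    obtain ⟨t, hm⟩ : ∃ t, (t, (0 : ℝ)) ∈ K :=
      ⟨_, h.body.horiz_mem hp hc hp2.le hc0.le (hp2.trans hc0)⟩
    obtain ⟨a, ha, ha'⟩ := h.body.exists_floor_horiz 0 (by simpa using hm)
    have hs := h.slab _ hm
    have hx : HCross K a 0 := ⟨⟨p, hp, hp2⟩, ⟨_, hc, hc0⟩, _, ha, ha', hm⟩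
    have h1 : a < 2 := by exact_mod_cast ha.trans hs.2
    have h2 : -2 < a := by
      have : (-1 : ℝ) < a + 1 := hs.1.trans ha'
      have : (-1 : ℤ) < a + 1 := by exact_mod_cast this
      omega
    interval_cases a
    · exact Or.inl (by simpa using hx)
    · exact Or.inr (Or.inl (by simpa using hx))
    · exact Or.inr (Or.inr (by simpa using hx))
  · push Not at hp
    exact Or.inl hp

lemma top_cases (h : IsWide K) :
    (∀ p ∈ K, p.2 ≤ 1) ∨ HCross K (-1) 1 ∨ HCross K 0 1 ∨ HCross K 1 1 := by
  have key : ∀ i, HCross (UnimodularMap.mirrorY.pre K) i 0 → HCross K i 1 := by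
    rintro i ⟨⟨p, hp, h1⟩, ⟨q, hq, h2⟩, t, ht0, ht1, ht⟩
    exact ⟨⟨_, (mem_mirrorY _).1 hq, by linarith⟩, ⟨_, (mem_mirrorY _).1 hp, by linarith⟩,
      t, ht0, ht1, by simpa using (mem_mirrorY _).1 ht⟩
  rcases h.mirrorY.bottom_cases with h1 | h1 | h1 | h1
  · left
    intro p hp
    have := h1 (p.1, 1 - p.2) ((mem_mirrorY _).2 (by simpa using hp))
    simpa using this
  · exact Or.inr (Or.inl (key _ h1))
  · exact Or.inr (Or.inr (Or.inl (key _ h1)))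
  · exact Or.inr (Or.inr (Or.inr (key _ h1)))

lemma le_one_mirrorY (h : ∀ p ∈ K, 0 ≤ p.2) : ∀ p ∈ UnimodularMap.mirrorY.pre K, p.2 ≤ 1 := by
  intro p hp
  have := h _ ((mem_mirrorY p).1 hp)
  simp only at this
  linarith

lemma le_one_mirrorC (h : ∀ p ∈ K, p.2 ≤ 1) : ∀ p ∈ UnimodularMap.mirrorC.pre K, p.2 ≤ 1 :=
  fun p hp => (h _ ((mem_mirrorC p).1 hp) :)

/-- A quarter turn of the unit square carries the bounded top side to the left side, as type III
requires. -/
lemma classified_of_center_le (h : IsWide K) (h1 : HCross K 0 0) (h2 : ∀ p ∈ K, p.2 ≤ 1) :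
    Classified K := by
  have hmem : ∀ p : ℝ × ℝ, p ∈ K →
      (1 - p.2, p.1) ∈ (⟨0, 1, -1, 0, 0, 1, by simp⟩ : UnimodularMap).pre K := by
    intro p hp
    rw [mem_pre]
    simpa using hp
  refine .of_pre ⟨0, 1, -1, 0, 0, 1, by simp⟩ (UnitType.classified (.three ?_ ?_ ?_ ?_))
  · obtain ⟨⟨p, hp, hp1⟩, ⟨q, hq, hq1⟩, t, ht0, ht1, ht⟩ := h.left
    exact ⟨⟨_, hmem p hp, hp1⟩, ⟨_, hmem q hq, hq1⟩, 1 - t, by linarith, by linarith, hmem _ ht⟩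
  · obtain ⟨⟨p, hp, hp1⟩, ⟨q, hq, hq1⟩, t, ht0, ht1, ht⟩ := h1
    exact ⟨⟨_, hmem q hq, by linarith⟩, ⟨_, hmem p hp, by linarith⟩, t, ht0, ht1,
      by simpa using hmem _ ht⟩
  · obtain ⟨⟨p, hp, hp1⟩, ⟨q, hq, hq1⟩, t, ht0, ht1, ht⟩ := h.right
    exact ⟨⟨_, hmem p hp, hp1⟩, ⟨_, hmem q hq, hq1⟩, 1 - t, by linarith, by linarith, hmem _ ht⟩
  · intro p hp
    have := h2 _ ((mem_pre _ p).1 hp)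
    push_cast at this
    linarith

lemma classified_of_left_le (h : IsWide K) (h1 : HCross K (-1) 0) (h2 : ∀ p ∈ K, p.2 ≤ 1) :
    Classified K :=
  UnitType.classified (.five h1 h.left fun p hp => ⟨(h.slab p hp).1.le, h2 p hp⟩)

lemma classified_of_left_left (h : IsWide K) (h1 : HCross K (-1) 0) (h2 : HCross K (-1) 1) :
    Classified K := by
  have hmem : ∀ p : ℝ × ℝ, p ∈ K → (p.1 + 1, p.2) ∈ (translation (-1) 0).pre K :=
    fun p hp => (mem_translation _ _ _).2 (by simpa using hp)
  refine .of_pre (translation (-1) 0) (UnitType.classified (.three ?_ ?_ ?_ ?_))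
  · obtain ⟨⟨p, hp, hp1⟩, ⟨q, hq, hq1⟩, t, ht0, ht1, ht⟩ := h1
    exact ⟨⟨_, hmem p hp, hp1⟩, ⟨_, hmem q hq, hq1⟩, t + 1, by linarith, by linarith, hmem _ ht⟩
  · obtain ⟨⟨p, hp, hp1⟩, ⟨q, hq, hq1⟩, t, ht0, ht1, ht⟩ := h.left
    exact ⟨⟨_, hmem p hp, by linarith⟩, ⟨_, hmem q hq, by linarith⟩, t, ht0, ht1,
      by simpa using hmem _ ht⟩
  · obtain ⟨⟨p, hp, hp1⟩, ⟨q, hq, hq1⟩, t, ht0, ht1, ht⟩ := h2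
    exact ⟨⟨_, hmem p hp, hp1⟩, ⟨_, hmem q hq, hq1⟩, t + 1, by linarith, by linarith, hmem _ ht⟩
  · intro p hp
    have := (h.slab _ ((mem_translation _ _ p).1 hp)).1
    push_cast at this
    linarith

/-- The left-edge point lies on the other side of `x₁ - x₂ = 1`, so `K` meets this diagonal. A
meeting point with `s < 0`, joined to the right-edge point, would cross `x₂ = 0` at a positive
abscissa, contrary to the gap `(-1, 0)`. -/
lemma exists_mem_diagonal (h : IsWide K) (h1 : HCross K (-1) 0) {p : ℝ × ℝ} (hp : p ∈ K)
    (hp1 : 1 ≤ p.1 - p.2) : ∃ s, 0 < s ∧ s < 1 ∧ (s + 1, s) ∈ K := by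
  obtain ⟨-, -, a, ha0, ha1, ha⟩ := h1
  obtain ⟨-, -, c, hc0, hc1, hc⟩ := h.left
  obtain ⟨-, -, d, hd0, hd1, hd⟩ := h.right
  obtain ⟨s, hs⟩ : ∃ s, (1, s) ∈ (⟨1, 1, 0, 1, 0, 0, by simp⟩ : UnimodularMap).pre K :=
    ⟨_, (h.body.pre ⟨1, 1, 0, 1, 0, 0, by simp⟩).vert_mem (p := (-c, c))
      (q := (p.1 - p.2, p.2)) (k := 1) (by rw [mem_pre]; simpa using hc)
      (by rw [mem_pre]; simpa using hp) (by simp only; linarith) hp1 (by simp only; linarith)⟩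
  replace hs : (s + 1, s) ∈ K := by
    rw [mem_pre] at hs
    simpa [add_comm] using hs
  have hs1 := (h.slab _ hs).2
  refine ⟨s, ?_, by linarith, hs⟩
  by_contra! hs0
  rcases hs0.eq_or_lt with rfl | hs0
  · exact h.body.free 1 0 (by simpa using hs)
  have := (h.body.horiz_bounds 0 (-1) (by simpa using ha) (by simpa using ha0)
    (by simpa using ha1) hs hd (by simpa using hs0.le) (by simpa using hd0.le)
    (hs0.trans hd0)).2
  push_cast at this
  nlinarith

lemma exists_mem_diagonal' (h : IsWide K) (h2 : HCross K 1 1) {p : ℝ × ℝ} (hp : p ∈ K)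
    (hp1 : p.1 - p.2 ≤ -1) : ∃ r, 0 < r ∧ r < 1 ∧ (-r, 1 - r) ∈ K := by
  obtain ⟨r, hr0, hr1, hr⟩ := h.mirrorC.mirrorY.exists_mem_diagonal
    (p := (1 - p.1, 1 - p.2)) (by simpa using h2.mirrorC.mirrorY)
    ((mem_mirrorY _).2 ((mem_mirrorC _).2 (by simpa using hp))) (by simp only; linarith)
  refine ⟨r, hr0, hr1, ?_⟩
  have := (mem_mirrorC _).1 ((mem_mirrorY _).1 hr)
  simpa using this

/-- Otherwise `K` contains a point `(s - 2, s)` with `1 < s < 4`. For `s ≤ 3`, joining it to the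
left-edge or right-edge point crosses `x₂ = 1` outside the gap `(1, 2)`; for `s > 3`, joining it to
the left-edge point crosses `x₁ = 1` too high. -/
lemma neg_two_lt (h : IsWide K) (h2 : HCross K 1 1) {p : ℝ × ℝ} (hp : p ∈ K) :
    -2 < p.1 - p.2 := by
  by_contra! hp1
  obtain ⟨-, -, b, hb0, hb1, hb⟩ := h2
  obtain ⟨-, -, c, hc0, hc1, hc⟩ := h.left
  obtain ⟨-, -, d, hd0, hd1, hd⟩ := h.right
  obtain ⟨s, hs⟩ : ∃ s, (-2, s) ∈ (⟨1, 1, 0, 1, 0, 0, by simp⟩ : UnimodularMap).pre K :=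
    ⟨_, (h.body.pre ⟨1, 1, 0, 1, 0, 0, by simp⟩).vert_mem (q := (-c, c))
      (p := (p.1 - p.2, p.2)) (k := -2) (by rw [mem_pre]; simpa using hp)
      (by rw [mem_pre]; simpa using hc) hp1 (by simp only; linarith) (by simp only; linarith)⟩
  replace hs : (s - 2, s) ∈ K := by
    rw [mem_pre] at hs
    simpa [sub_eq_neg_add] using hs
  have hs0 := h.slab _ hs
  simp only at hs0
  have hb := fun x y (hx : (x, y) ∈ K) (hy : y < 1) =>
    (h.body.horiz_bounds 1 1 (by simpa using hb) (by simpa using hb0) (by norm_num; linarith)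
    hx hs (by simpa using hy.le) (by push_cast; linarith) (by simp only; linarith)).1
  rcases le_or_gt s 3 with hs3 | hs3
  · rcases le_or_gt s 2 with hs2 | hs2
    · have := hb _ _ hc (by linarith)
      push_cast at this
      nlinarith
    · have := hb _ _ hd (by linarith)
      push_cast at this
      nlinarith
  · have := (h.bounds_right hc hs (by simp) (by simp only; linarith) (by simp only; linarith)).2
    nlinarith

/-- In the coordinate `x₁ - x₂` the body lies between `-2` and `1`. Passing below `-1` makes it
cross a diagonal edge and gives type IV after a shear; otherwise it fits into a slab of width two.
-/
lemma classified_of_left_right_of_lt (h : IsWide K) (h1 : HCross K (-1) 0) (h2 : HCross K 1 1)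
    (hlt : ∀ p ∈ K, p.1 - p.2 < 1) : Classified K := by
  by_cases hex : ∃ p ∈ K, p.1 - p.2 < -1
  · obtain ⟨p, hp, hp1⟩ := hex
    obtain ⟨r, hr0, hr1, hr⟩ := h.exists_mem_diagonal' h2 hp hp1.le
    obtain ⟨-, -, c, hc0, hc1, hc⟩ := h.left
    obtain ⟨-, -, d, hd0, hd1, hd⟩ := h.right
    have hmem : ∀ p : ℝ × ℝ, p ∈ K →
        (p.1 - p.2 + 1, p.2) ∈ (⟨1, 1, 0, 1, -1, 0, by simp⟩ : UnimodularMap).pre K := by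
      intro p hp
      rw [mem_pre]
      convert hp using 1
      ext <;> simp; ring
    refine .of_pre ⟨1, 1, 0, 1, -1, 0, by simp⟩ (UnitType.classified (.four ?_ ?_ ?_ ?_ ?_))
    · exact ⟨⟨_, hmem p hp, by simp only; linarith⟩, ⟨_, hmem _ hc, by simp only; linarith⟩,
        1 - r, by linarith, by linarith, by convert hmem _ hr using 2; ring⟩
    · obtain ⟨⟨p, hp, hp1⟩, ⟨q, hq, hq1⟩, t, ht0, ht1, ht⟩ := h1
      exact ⟨⟨_, hmem p hp, hp1⟩, ⟨_, hmem q hq, hq1⟩, t + 1, by linarith, by linarith,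
        by simpa using hmem _ ht⟩
    · have := (h.body.pre ⟨1, 1, 0, 1, -1, 0, by simp⟩).vcross_of_le 1 0 (hmem _ hc) (hmem _ hd)
        (by push_cast; linarith) (by push_cast; linarith)
        (by push_cast; nlinarith) (by push_cast; nlinarith)
      simpa using this
    · obtain ⟨⟨p, hp, hp1⟩, ⟨q, hq, hq1⟩, t, ht0, ht1, ht⟩ := h2
      exact ⟨⟨_, hmem p hp, hp1⟩, ⟨_, hmem q hq, hq1⟩, t, by linarith, by linarith,
        by simpa using hmem _ ht⟩
    · intro p hp
      have h3 := hlt _ ((mem_pre _ p).1 hp)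
      have h4 := h.neg_two_lt h2 ((mem_pre _ p).1 hp)
      push_cast at h3 h4
      constructor <;> linarith
  · push Not at hex
    refine .of_pre ⟨1, 1, 0, 1, 0, 0, by simp⟩
      ((h.body.pre _).classified_of_slab_two fun p hp => ?_)
    have h3 := hlt _ ((mem_pre _ p).1 hp)
    have h4 := hex _ ((mem_pre _ p).1 hp)
    push_cast at h3 h4
    constructor <;> linarith

/-- If `K` reaches both diagonals `x₁ - x₂ = ±1`, the coordinates `(x₁ - 2x₂ + 1, x₂)` bring the two
horizontal crossings over the same unit interval. The diagonal points then lie on opposite sides of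
the square, giving type II. If one diagonal is missed, the previous lemma applies, possibly after a
half turn. -/
lemma classified_of_left_right (h : IsWide K) (h1 : HCross K (-1) 0) (h2 : HCross K 1 1) :
    Classified K := by
  by_cases hm : ∃ p ∈ K, 1 ≤ p.1 - p.2
  · by_cases hm' : ∃ p ∈ K, p.1 - p.2 ≤ -1
    · obtain ⟨p, hp, hp1⟩ := hm
      obtain ⟨s, hs0, hs1, hs⟩ := h.exists_mem_diagonal h1 hp hp1
      obtain ⟨q, hq, hq1⟩ := hm'
      obtain ⟨r, hr0, hr1, hr⟩ := h.exists_mem_diagonal' h2 hq hq1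
      obtain ⟨⟨p, hp, hp1⟩, ⟨q, hq, hq1⟩, a, ha0, ha1, ha⟩ := h1
      obtain ⟨⟨p', hp', hp1'⟩, ⟨q', hq', hq1'⟩, b, hb0, hb1, hb⟩ := h2
      have hmem : ∀ p : ℝ × ℝ, p ∈ K →
          (p.1 - 2 * p.2 + 1, p.2) ∈ (⟨1, 2, 0, 1, -1, 0, by simp⟩ : UnimodularMap).pre K := by
        intro p hp
        rw [mem_pre]
        convert hp using 1
        ext <;> simp; ring
      have hB := h.body.pre ⟨1, 2, 0, 1, -1, 0, by simp⟩
      refine .of_pre ⟨1, 2, 0, 1, -1, 0, by simp⟩ (UnitType.classified (.two ?_ ?_ ?_ ?_))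
      · exact ⟨⟨_, hmem p hp, hp1⟩, ⟨_, hmem q hq, hq1⟩, a + 1, by linarith, by linarith,
          by simpa using hmem _ ha⟩
      · have := hB.vcross_of_le 1 0 (hmem _ ha) (hmem _ hs)
          (by push_cast; linarith) (by push_cast; linarith)
          (by push_cast; nlinarith) (by push_cast; nlinarith)
        simpa using this
      · refine ⟨⟨_, hmem _ hp', hp1'⟩, ⟨_, hmem _ hq', hq1'⟩, b - 1, by linarith, by linarith, ?_⟩
        convert hmem _ hb using 2
        ring
      · have := hB.vcross_of_le 0 0 (hmem _ hr) (hmem _ ha)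
          (by push_cast; linarith) (by push_cast; linarith)
          (by push_cast; nlinarith) (by push_cast; nlinarith)
        simpa using this
    · push Not at hm'
      refine .of_pre UnimodularMap.mirrorC (.of_pre UnimodularMap.mirrorY
        (h.mirrorC.mirrorY.classified_of_left_right_of_lt (by simpa using h2.mirrorC.mirrorY)
          (by simpa using h1.mirrorC.mirrorY) fun p hp => ?_))
      have := hm' _ ((mem_mirrorC _).1 ((mem_mirrorY _).1 hp))
      simp only at this
      linarith
  · push Not at hm
    exact h.classified_of_left_right_of_lt h1 h2 hm

lemma classified_of_center_right (h : IsWide K) (h1 : HCross K 0 0) (h2 : HCross K 1 1) :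
    Classified K :=
  UnitType.classified (.four h.left h1 h.right h2 h.slab)

/-- The bottom and top alternatives give sixteen patterns, which the two reflections of the unit
square reduce to the cases above. -/
theorem classified (h : IsWide K) : Classified K := by
  have hC := h.mirrorC
  have hY := h.mirrorY
  have hCY := h.mirrorC.mirrorY
  have ofC : Classified (UnimodularMap.mirrorC.pre K) → Classified K := .of_pre _
  have ofY : Classified (UnimodularMap.mirrorY.pre K) → Classified K := .of_pre _
  have ofCY : Classified (UnimodularMap.mirrorY.pre (UnimodularMap.mirrorC.pre K)) →
      Classified K := fun h => .of_pre _ (.of_pre _ h)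
  rcases h.bottom_cases with h1 | h1 | h1 | h1 <;> rcases h.top_cases with h2 | h2 | h2 | h2
  · exact .of_pre swap (UnitType.classified (.one fun p hp =>
      ⟨h1 _ (mem_swap.1 hp), h2 _ (mem_swap.1 hp)⟩))
  · exact ofY (hY.classified_of_left_le (by simpa using h2.mirrorY) (le_one_mirrorY h1))
  · exact ofY (hY.classified_of_center_le (by simpa using h2.mirrorY) (le_one_mirrorY h1))
  · refine ofC (.of_pre _ (hCY.classified_of_left_le (by simpa using h2.mirrorC.mirrorY)
      (le_one_mirrorY fun p hp => (h1 _ ((mem_mirrorC p).1 hp) :))))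
  · exact h.classified_of_left_le h1 h2
  · exact h.classified_of_left_left h1 h2
  · exact ofCY (hCY.classified_of_center_right (by simpa using h2.mirrorC.mirrorY)
      (by simpa using h1.mirrorC.mirrorY))
  · exact h.classified_of_left_right h1 h2
  · exact h.classified_of_center_le h1 h2
  · exact ofC (hC.classified_of_center_right (by simpa using h1.mirrorC)
      (by simpa using h2.mirrorC))
  · exact UnitType.classified (.two h1 h.right h2 h.left)
  · exact h.classified_of_center_right h1 h2
  · exact ofC (hC.classified_of_left_le (by simpa using h1.mirrorC) (le_one_mirrorC h2))
  · exact ofC (hC.classified_of_left_right (by simpa using h1.mirrorC) (by simpa using h2.mirrorC))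
  · exact ofY (hY.classified_of_center_right (by simpa using h2.mirrorY)
      (by simpa using h1.mirrorY))
  · exact ofC (hC.classified_of_left_left (by simpa using h1.mirrorC) (by simpa using h2.mirrorC))

end IsWide

/-- A free body in the open slab `-1 < x₁ < 2` is classified. -/
theorem IsFreeBody.classified_of_slab_three {K : Set (ℝ × ℝ)} (hK : IsFreeBody K)
    (hs : ∀ p ∈ K, -1 < p.1 ∧ p.1 < 2) : Classified K := by
  by_cases h1 : ∃ p ∈ K, p.1 < 0
  swap
  · push Not at h1
    refine .of_pre (translation 1 0) ((hK.pre _).classified_of_slab_two fun p hp => ?_)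
    have h3 := h1 _ ((mem_translation _ _ p).1 hp)
    have h4 := hs _ ((mem_translation _ _ p).1 hp)
    push_cast at h3 h4
    constructor <;> linarith
  by_cases h2 : ∃ p ∈ K, 1 < p.1
  swap
  · push Not at h2
    exact hK.classified_of_slab_two fun p hp => ⟨(hs p hp).1.le, h2 p hp⟩
  obtain ⟨p, hp, hp1⟩ := h1
  obtain ⟨q, hq, hq1⟩ := h2
  obtain ⟨c, hc⟩ : ∃ c, ((0 : ℝ), c) ∈ K :=
    ⟨_, hK.vert_mem hp hq hp1.le (by linarith) (by linarith)⟩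
  obtain ⟨d, hd⟩ : ∃ d, ((1 : ℝ), d) ∈ K :=
    ⟨_, hK.vert_mem hp hq (by linarith) hq1.le (by linarith)⟩
  obtain ⟨a, ha, ha'⟩ := hK.exists_floor_vert 0 (by simpa using hc)
  obtain ⟨b, hb, hb'⟩ := hK.exists_floor_vert 1 (by simpa using hd)
  -- The shear by `b - a` and the translation by `a` put both crossings into row 0.
  have hmem : ∀ p : ℝ × ℝ, p ∈ K →
      (p.1, p.2 - (b - a) * p.1 - a) ∈ (⟨1, 0, b - a, 1, 0, a, by simp⟩ : UnimodularMap).pre K := by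
    intro p hp
    rw [mem_pre]
    convert hp using 1
    ext <;> simp; ring
  refine .of_pre ⟨1, 0, b - a, 1, 0, a, by simp⟩
    (IsWide.classified ⟨hK.pre _, fun p hp => ?_, ?_, ?_⟩)
  · have := hs _ ((mem_pre _ p).1 hp)
    simpa using this
  · exact ⟨⟨_, hmem p hp, hp1⟩, ⟨_, hmem q hq, by simp only; linarith⟩,
      c - a, by linarith, by linarith, by simpa using hmem _ hc⟩
  · exact ⟨⟨_, hmem p hp, by simp only; linarith⟩, ⟨_, hmem q hq, hq1⟩,
      d - b, by linarith, by linarith, by convert hmem _ hd using 2; ring⟩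

/-! ### Open slabs of width four -/

/-- A free body in the open slab `-2 < x₁ < 2` that meets the lines `x₁ = -1`, `x₁ = 0` and
`x₁ = 1` in the rows `m`, `0` and `0`. -/
structure IsTriple (m : ℤ) (K : Set (ℝ × ℝ)) : Prop where
  body : IsFreeBody K
  slab : ∀ p ∈ K, -2 < p.1 ∧ p.1 < 2
  left : ∃ d : ℝ, m < d ∧ d < m + 1 ∧ (-1, d) ∈ K
  center : ∃ b : ℝ, 0 < b ∧ b < 1 ∧ (0, b) ∈ K
  right : ∃ c : ℝ, 0 < c ∧ c < 1 ∧ (1, c) ∈ K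

namespace IsTriple

variable {K : Set (ℝ × ℝ)} {m : ℤ}

lemma mirrorY (h : IsTriple m K) : IsTriple (-m) (mirrorY.pre K) where
  body := h.body.pre _
  slab p hp := (h.slab _ ((mem_mirrorY p).1 hp) :)
  left := by
    obtain ⟨d, h0, h1, hd⟩ := h.left
    exact ⟨1 - d, by push_cast; linarith, by push_cast; linarith,
      (mem_mirrorY _).2 (by simpa using hd)⟩
  center := by
    obtain ⟨d, h0, h1, hd⟩ := h.center
    exact ⟨1 - d, by linarith, by linarith, (mem_mirrorY _).2 (by simpa using hd)⟩
  right := by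
    obtain ⟨d, h0, h1, hd⟩ := h.right
    exact ⟨1 - d, by linarith, by linarith, (mem_mirrorY _).2 (by simpa using hd)⟩

lemma bounds_left (h : IsTriple m K) {p q : ℝ × ℝ} (hp : p ∈ K) (hq : q ∈ K) (h1 : p.1 ≤ -1)
    (h2 : -1 ≤ q.1) (hpq : p.1 < q.1) :
    m * (q.1 - p.1) < p.2 * (q.1 + 1) + q.2 * (-1 - p.1) ∧
      p.2 * (q.1 + 1) + q.2 * (-1 - p.1) < (m + 1) * (q.1 - p.1) := by
  obtain ⟨t, ht0, ht1, ht⟩ := h.left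
  have := h.body.vert_bounds (-1) m (by simpa using ht) ht0 ht1
    hp hq (by simpa using h1) (by simpa using h2) hpq
  push_cast at this
  constructor <;> linarith

lemma bounds_center (h : IsTriple m K) {p q : ℝ × ℝ} (hp : p ∈ K) (hq : q ∈ K) (h1 : p.1 ≤ 0)
    (h2 : 0 ≤ q.1) (hpq : p.1 < q.1) :
    0 < p.2 * q.1 - q.2 * p.1 ∧ p.2 * q.1 - q.2 * p.1 < q.1 - p.1 := by
  obtain ⟨t, ht0, ht1, ht⟩ := h.center
  have := h.body.vert_bounds 0 0 (by simpa using ht) (by simpa using ht0) (by simpa using ht1)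
    hp hq (by simpa using h1) (by simpa using h2) hpq
  push_cast at this
  constructor <;> linarith

lemma bounds_right (h : IsTriple m K) {p q : ℝ × ℝ} (hp : p ∈ K) (hq : q ∈ K) (h1 : p.1 ≤ 1)
    (h2 : 1 ≤ q.1) (hpq : p.1 < q.1) :
    0 < p.2 * (q.1 - 1) + q.2 * (1 - p.1) ∧
      p.2 * (q.1 - 1) + q.2 * (1 - p.1) < q.1 - p.1 := by
  obtain ⟨t, ht0, ht1, ht⟩ := h.right
  have := h.body.vert_bounds 1 0 (by simpa using ht) (by simpa using ht0) (by simpa using ht1)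
    hp hq (by simpa using h1) (by simpa using h2) hpq
  push_cast at this
  constructor <;> linarith

/-- A lower point, joined to the known crossing on `x₁ = 1` or `x₁ = -1`, would pass below row 0 on
one of the three lattice lines. -/
lemma neg_one_lt (h : IsTriple 0 K) {p : ℝ × ℝ} (hp : p ∈ K) : -1 < p.2 := by
  by_contra! hlt
  obtain ⟨hs, hs'⟩ := h.slab p hp
  obtain ⟨d, hd0, hd1, hd⟩ := h.left
  obtain ⟨c, hc0, hc1, hc⟩ := h.right
  push_cast at hd0 hd1
  rcases le_or_gt p.1 0 with h0 | h0
  · rcases le_or_gt p.1 (-1) with h1 | h1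
    · have := (h.bounds_left hp hc h1 (by norm_num) (by simp only; linarith)).1
      push_cast at this
      nlinarith
    · have := (h.bounds_center hp hc h0 (by norm_num) (by simp only; linarith)).1
      simp only at this
      nlinarith
  · rcases le_or_gt 1 p.1 with h1 | h1
    · have := (h.bounds_right hd hp (by norm_num) h1 (by simp only; linarith)).1
      simp only at this
      nlinarith
    · have := (h.bounds_center hd hp (by norm_num) h0.le (by simp only; linarith)).1
      simp only at this
      nlinarith

lemma classified_of_flat (h : IsTriple 0 K) : Classified K := by
  refine .of_pre swap ((h.body.pre _).classified_of_slab_three fun p hp => ?_)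
  have h1 := h.neg_one_lt (mem_swap.1 hp)
  have h2 := (show IsTriple 0 _ by simpa using h.mirrorY).neg_one_lt (p := (p.2, 1 - p.1))
    ((mem_mirrorY _).2 (by simpa using mem_swap.1 hp))
  simp only at h1 h2
  constructor <;> linarith

/-- This and the next three lemmas locate the points that violate either candidate slab, `-2 < x₁ -
x₂ < 1` or `-1 < x₂ < 2`, so that violations of both can be played against each other. -/
lemma diagonal_ge (h : IsTriple (-1) K) {q : ℝ × ℝ} (hq : q ∈ K) (hq1 : 1 ≤ q.1 - q.2) {d : ℝ}
    (hd : (-1, d) ∈ K) (hd1 : d < 0) : 1 < q.1 ∧ -d * q.1 < q.2 := by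
  obtain ⟨c, hc0, hc1, hc⟩ := h.right
  rcases le_or_gt q.1 0 with h0 | h0
  · have := (h.bounds_center hq hc h0 (by norm_num) (by simp only; linarith)).1
    simp only at this
    nlinarith
  have := (h.bounds_center hd hq (by norm_num) h0.le (by simp only; linarith)).1
  simp only at this
  exact ⟨by nlinarith, by linarith⟩

lemma diagonal_le (h : IsTriple (-1) K) {q : ℝ × ℝ} (hq : q ∈ K) (hq1 : q.1 - q.2 ≤ -2) :
    -1 < q.1 ∧ q.1 < 0 := by
  obtain ⟨hs, hs'⟩ := h.slab q hq
  obtain ⟨d, hd0, hd1, hd⟩ := h.left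
  obtain ⟨c, hc0, hc1, hc⟩ := h.right
  push_cast at hd0 hd1
  constructor
  · by_contra! h0
    have := (h.bounds_left hq hc h0 (by norm_num) (by simp only; linarith)).2
    push_cast at this
    nlinarith
  · by_contra! h0
    have h3 := (h.bounds_center hd hq (by norm_num) h0 (by simp only; linarith)).2
    simp only at h3
    rcases le_or_gt 1 q.1 with h1 | h1
    · have := (h.bounds_right hd hq (by norm_num) h1 (by simp only; linarith)).2
      simp only at this
      nlinarith
    · nlinarith

lemma two_le (h : IsTriple (-1) K) {p : ℝ × ℝ} (hp : p ∈ K) (hp2 : 2 ≤ p.2) :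
    0 < p.1 ∧ p.1 < 1 := by
  obtain ⟨hs, hs'⟩ := h.slab p hp
  obtain ⟨d, hd0, hd1, hd⟩ := h.left
  obtain ⟨c, hc0, hc1, hc⟩ := h.right
  push_cast at hd0 hd1
  constructor
  · by_contra! h0
    have h3 := (h.bounds_center hp hc h0 (by norm_num) (by simp only; linarith)).2
    simp only at h3
    rcases le_or_gt p.1 (-1) with h1 | h1
    · have := (h.bounds_left hp hc h1 (by norm_num) (by simp only; linarith)).2
      push_cast at this
      nlinarith
    · nlinarith
  · by_contra! h1
    have := (h.bounds_right hd hp (by norm_num) h1 (by simp only; linarith)).2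
    simp only at this
    nlinarith

lemma le_neg_one (h : IsTriple (-1) K) {p : ℝ × ℝ} (hp : p ∈ K) (hp2 : p.2 ≤ -1) {c : ℝ}
    (hc : (1, c) ∈ K) (hc1 : c < 1) : p.1 < -1 ∧ -(c * p.1) > -p.2 := by
  obtain ⟨hs, hs'⟩ := h.slab p hp
  obtain ⟨d, hd0, hd1, hd⟩ := h.left
  push_cast at hd0 hd1
  rcases le_or_gt 0 p.1 with h0 | h0
  · have := (h.bounds_center hd hp (by norm_num) h0 (by simp only; linarith)).1
    simp only at this
    nlinarith
  · have := (h.bounds_center hp hc h0.le (by norm_num) (by simp only; linarith)).1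
    simp only at this
    exact ⟨by nlinarith, by linarith⟩

/-- A point violating the horizontal slab at the top is incompatible with a violation of the
diagonal slab on either side. -/
lemma diagonal_bounds_of_top (h : IsTriple (-1) K) {p q : ℝ × ℝ} (hp : p ∈ K) (hp2 : 2 ≤ p.2)
    (hq : q ∈ K) : -2 < q.1 - q.2 ∧ q.1 - q.2 < 1 := by
  obtain ⟨hp0, hp1⟩ := h.two_le hp hp2
  obtain ⟨d, hd0, hd1, hd⟩ := h.left
  obtain ⟨c, hc0, hc1, hc⟩ := h.right
  push_cast at hd0 hd1
  constructor
  · by_contra! hlt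
    obtain ⟨h1, h2⟩ := h.diagonal_le hq hlt
    -- This chord crosses `x₂ = 1` in the gap `(0, 1)`, while the chord from `(-1, d)` to `q`
    -- crosses it at a negative abscissa.
    have hm := h.body.horiz_mem hc hp (k := 1) hc1.le (by linarith) (by simp only; linarith)
    have h3 := (h.body.horiz_bounds 1 0 (by simpa using hm)
      (by push_cast; apply div_pos <;> nlinarith)
      (by push_cast; rw [div_lt_iff₀ (by linarith)]; nlinarith) hd hq (by push_cast; linarith)
      (by push_cast; linarith) (by simp only; linarith)).1
    push_cast at h3
    nlinarith
  · by_contra! hlt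
    obtain ⟨h1, h2⟩ := h.diagonal_ge hq hlt hd (by linarith)
    have hsq := (h.slab q hq).2
    have h3 := (h.bounds_right hp hq hp1.le h1.le (by linarith)).2
    have h4 := (h.bounds_center hd hp (by norm_num) hp0.le (by simp only; linarith)).2
    simp only at h4
    obtain ⟨e, rfl⟩ : ∃ e, d = -e := ⟨-d, by ring⟩
    generalize q.1 = Q at *
    generalize p.1 = P at *
    have hP : 1 < P * (1 + e) := by nlinarith
    have hQ : 1 < Q * (1 - e) := by nlinarith
    have h5 : Q - 2 + P + e * Q * (1 - P) < 0 := by nlinarith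
    have he : 0 < 1 - 2 * e := by nlinarith
    -- The left side of `h5` increases in `Q`; once `Q` is replaced by its lower bound `1/(1 - e)`,
    -- it increases in `P`. At `P = 1/(1 + e)`, multiplying by `(1 - e)(1 + e)` leaves `3e² ≥ 0`,
    -- contradicting `h5`.
    have h6 : 0 < (Q * (1 - e) - 1) * (1 + e * (1 - P)) :=
      mul_pos (by linarith) (by nlinarith)
    have h7 : 0 < (P * (1 + e) - 1) * (1 - 2 * e) := mul_pos (by linarith) he
    have h8 : (1 - e) * (1 + e) * (Q - 2 + P + e * Q * (1 - P)) < 0 :=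
      mul_neg_of_pos_of_neg (mul_pos (by linarith) (by linarith)) h5
    nlinarith [mul_pos (show 0 < 1 + e by linarith) h6, sq_nonneg e]

lemma diagonal_bounds_of_bottom (h : IsTriple (-1) K) {p q : ℝ × ℝ} (hp : p ∈ K)
    (hp2 : p.2 ≤ -1) (hq : q ∈ K) : -2 < q.1 - q.2 ∧ q.1 - q.2 < 1 := by
  obtain ⟨d, hd0, hd1, hd⟩ := h.left
  obtain ⟨c, hc0, hc1, hc⟩ := h.right
  push_cast at hd0 hd1
  obtain ⟨hp0, hp1⟩ := h.le_neg_one hp hp2 hc hc1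
  obtain ⟨hs, hs'⟩ := h.slab p hp
  obtain ⟨hsq, hsq'⟩ := h.slab q hq
  constructor
  · by_contra! hlt
    obtain ⟨h1, h2⟩ := h.diagonal_le hq hlt
    have h3 := (h.bounds_center hq hc h2.le (by norm_num) (by simp only; linarith)).2
    have h4 := (h.bounds_left hp hq hp0.le h1.le (by linarith)).2
    push_cast at h4
    simp only at h3
    obtain ⟨r, hr⟩ : ∃ r, q.1 = -r := ⟨-q.1, by ring⟩
    obtain ⟨t, ht⟩ : ∃ t, p.1 = -t := ⟨-p.1, by ring⟩
    rw [hr, ht] at *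
    have hR : 1 < r * (2 - c) := by nlinarith
    have hT : 1 < c * t := by nlinarith
    have h5 : (2 - r) * (t - 1) - c * t * (1 - r) < 0 := by nlinarith
    have hc2 : 0 < 2 * c - 1 := by nlinarith
    -- The same monotonicity argument: at the lower bounds `t = 1/c` and then `r = 1/(2 - c)`, the
    -- left side of `h5` times `c(2 - c)` is `3(1 - c)² ≥ 0`.
    have h6 : 0 < (c * t - 1) * (2 - r - c * (1 - r)) :=
      mul_pos (by linarith) (by nlinarith)
    have h7 : 0 < (r * (2 - c) - 1) * (2 * c - 1) := mul_pos (by linarith) hc2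
    have h8 : c * (2 - c) * ((2 - r) * (t - 1) - c * t * (1 - r)) < 0 :=
      mul_neg_of_pos_of_neg (mul_pos hc0 (by linarith)) h5
    nlinarith [mul_pos (show 0 < 2 - c by linarith) h6, sq_nonneg (1 - c)]
  · by_contra! hlt
    obtain ⟨h1, h2⟩ := h.diagonal_ge hq hlt hd (by linarith)
    have := (h.bounds_center hp hq (by linarith) (by linarith) (by linarith)).1
    nlinarith

lemma classified_of_skew (h : IsTriple (-1) K) : Classified K := by
  by_cases hex : ∃ p ∈ K, p.2 ≤ -1 ∨ 2 ≤ p.2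
  · obtain ⟨p, hp, hp2⟩ := hex
    have key : ∀ q ∈ K, -2 < q.1 - q.2 ∧ q.1 - q.2 < 1 := by
      intro q hq
      rcases hp2 with hp2 | hp2
      · exact h.diagonal_bounds_of_bottom hp hp2 hq
      · exact h.diagonal_bounds_of_top hp hp2 hq
    refine .of_pre ⟨1, 1, 0, 1, -1, 0, by simp⟩
      ((h.body.pre _).classified_of_slab_three fun p hp => ?_)
    have := key _ ((mem_pre _ p).1 hp)
    push_cast at this
    constructor <;> linarith
  · push Not at hex
    exact .of_pre swap ((h.body.pre _).classified_of_slab_three fun p hp =>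
      hex _ (mem_swap.1 hp))

/-- The chord between the crossings on `x₁ = ±1` has its midpoint in the central gap, so `0 < c + d
< 2`; hence `m` is `-1`, `0` or `1`, and the extreme values are mirror images. -/
theorem classified (h : IsTriple m K) : Classified K := by
  obtain ⟨d, hd0, hd1, hd⟩ := h.left
  obtain ⟨c, hc0, hc1, hc⟩ := h.right
  have h1 := h.bounds_center hd hc (by norm_num) (by norm_num) (by norm_num)
  simp only at h1
  have h2 : (-2 : ℝ) < m := by linarith
  have h3 : (m : ℝ) < 2 := by linarith
  have h2' : -2 < m := by exact_mod_cast h2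
  have h3' : m < 2 := by exact_mod_cast h3
  interval_cases m
  · exact h.classified_of_skew
  · exact h.classified_of_flat
  · exact .of_pre _ h.mirrorY.classified_of_skew

end IsTriple

/-- A free body in the open slab `-2 < x₁ < 2` is classified. -/
theorem IsFreeBody.classified_of_slab_four {K : Set (ℝ × ℝ)} (hK : IsFreeBody K)
    (hs : ∀ p ∈ K, -2 < p.1 ∧ p.1 < 2) : Classified K := by
  by_cases h1 : ∃ p ∈ K, p.1 ≤ -1
  swap
  · push Not at h1
    exact hK.classified_of_slab_three fun p hp => ⟨h1 p hp, (hs p hp).2⟩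
  by_cases h2 : ∃ p ∈ K, 1 ≤ p.1
  swap
  · push Not at h2
    refine .of_pre (translation (-1) 0) ((hK.pre _).classified_of_slab_three fun p hp => ?_)
    have h3 := h2 _ ((mem_translation _ _ p).1 hp)
    have h4 := hs _ ((mem_translation _ _ p).1 hp)
    push_cast at h3 h4
    constructor <;> linarith
  obtain ⟨p, hp, hp1⟩ := h1
  obtain ⟨q, hq, hq1⟩ := h2
  obtain ⟨d, hd⟩ : ∃ d, ((-1 : ℝ), d) ∈ K :=
    ⟨_, hK.vert_mem hp hq hp1 (by linarith) (by linarith)⟩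
  obtain ⟨b, hb⟩ : ∃ b, ((0 : ℝ), b) ∈ K :=
    ⟨_, hK.vert_mem hp hq (by linarith) (by linarith) (by linarith)⟩
  obtain ⟨c, hc⟩ : ∃ c, ((1 : ℝ), c) ∈ K :=
    ⟨_, hK.vert_mem hp hq (by linarith) hq1 (by linarith)⟩
  obtain ⟨i, hi, hi'⟩ := hK.exists_floor_vert (-1) (by simpa using hd)
  obtain ⟨j, hj, hj'⟩ := hK.exists_floor_vert 0 (by simpa using hb)
  obtain ⟨k, hk, hk'⟩ := hK.exists_floor_vert 1 (by simpa using hc)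
  have hmem : ∀ p : ℝ × ℝ, p ∈ K →
      (p.1, p.2 - (k - j) * p.1 - j) ∈ (⟨1, 0, k - j, 1, 0, j, by simp⟩ : UnimodularMap).pre K := by
    intro p hp
    rw [mem_pre]
    convert hp using 1
    ext <;> simp; ring
  refine .of_pre ⟨1, 0, k - j, 1, 0, j, by simp⟩
    (IsTriple.classified (m := i + (k - j) - j) ⟨hK.pre _, fun p hp => ?_, ?_, ?_, ?_⟩)
  · have := hs _ ((mem_pre _ p).1 hp)
    simpa using this
  · exact ⟨d + (k - j) - j, by push_cast; linarith, by push_cast; linarith,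
      by convert hmem _ hd using 2; ring⟩
  · exact ⟨b - j, by linarith, by linarith, by simpa using hmem _ hb⟩
  · exact ⟨c - k, by linarith, by linarith, by convert hmem _ hc using 2; ring⟩

/-- A free body of horizontal width less than `3` is classified. -/
theorem IsFreeBody.classified_of_width_lt {K : Set (ℝ × ℝ)} (hK : IsFreeBody K) {r : ℝ}
    (hr : r < 3) (hw : ∀ p ∈ K, ∀ q ∈ K, p.1 - q.1 ≤ r) : Classified K := by
  obtain ⟨z, hz⟩ := hK.nonempty_interior
  have hz := interior_subset hz
  have hbd : BddBelow (Prod.fst '' K) := ⟨z.1 - r, by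
    rintro _ ⟨p, hp, rfl⟩
    linarith [hw z hz p hp]⟩
  set lo := sInf (Prod.fst '' K)
  have h1 : ∀ p ∈ K, lo ≤ p.1 := fun p hp => csInf_le hbd ⟨p, hp, rfl⟩
  have h2 : ∀ p ∈ K, p.1 ≤ lo + r := by
    intro p hp
    have : p.1 - r ≤ lo := le_csInf ⟨z.1, z, hz, rfl⟩ (by
      rintro _ ⟨q, hq, rfl⟩
      linarith [hw p hp q hq])
    linarith
  -- The left end moves to `lo - ⌈lo⌉ - 1 > -2`, and the right end to at most `r - 1 < 2`.
  refine .of_pre (translation (⌈lo⌉ + 1) 0)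
    ((hK.pre _).classified_of_slab_four fun p hp => ?_)
  have h3 := h1 _ ((mem_translation _ _ p).1 hp)
  have h4 := h2 _ ((mem_translation _ _ p).1 hp)
  push_cast at h3 h4
  have := Int.le_ceil lo
  have := Int.ceil_lt_add_one lo
  constructor <;> linarith

/-! ### Chords and the bound on lattice width -/

/-- `v` is `s` times a difference of two points of `K`. -/
def Chord (K : Set (ℝ × ℝ)) (s : ℝ) (v : ℝ × ℝ) : Prop :=
  0 ≤ s ∧ ∃ a ∈ K, ∃ b ∈ K, v = s • (a - b)

namespace Chord

variable {K : Set (ℝ × ℝ)} {s t : ℝ} {v w : ℝ × ℝ}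

lemma mono (hK : Convex ℝ K) (h : Chord K s v) (hst : s ≤ t) : Chord K t v := by
  obtain ⟨hs, a, ha, b, hb, rfl⟩ := h
  rcases (hs.trans hst).eq_or_lt with h0 | h0
  · obtain rfl : s = 0 := le_antisymm (hst.trans_eq h0.symm) hs
    exact ⟨h0.le, a, ha, a, ha, by simp⟩
  · refine ⟨h0.le, a, ha, (1 - s / t) • a + (s / t) • b, hK ha hb ?_ ?_ (by ring), ?_⟩
    · rw [sub_nonneg, div_le_one h0]
      exact hst
    · positivity
    · have : s = t * (s / t) := by field_simp
      generalize s / t = c at *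
      subst this
      module

lemma smul (h : Chord K s v) (c : ℝ) : Chord K (|c| * s) (c • v) := by
  obtain ⟨hs, a, ha, b, hb, rfl⟩ := h
  refine ⟨by positivity, ?_⟩
  rcases abs_cases c with ⟨h1, -⟩ | ⟨h1, -⟩
  · exact ⟨a, ha, b, hb, by rw [h1, smul_smul]⟩
  · exact ⟨b, hb, a, ha, by rw [h1]; module⟩

lemma add (hK : Convex ℝ K) (h : Chord K s v) (h' : Chord K t w) : Chord K (s + t) (v + w) := by
  obtain ⟨hs, a, ha, b, hb, rfl⟩ := h
  obtain ⟨ht, a', ha', b', hb', rfl⟩ := h'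
  rcases (add_nonneg hs ht).eq_or_lt with h0 | h0
  · obtain rfl : s = 0 := by linarith
    obtain rfl : t = 0 := by linarith
    exact ⟨by simp, a, ha, a, ha, by simp⟩
  · have hsum : s / (s + t) + t / (s + t) = 1 := by field_simp
    have h1 : 0 ≤ s / (s + t) := by positivity
    have h2 : 0 ≤ t / (s + t) := by positivity
    refine ⟨h0.le, _, hK ha ha' h1 h2 hsum, _, hK hb hb' h1 h2 hsum, ?_⟩
    have e1 : (s + t) * (s / (s + t)) = s := by field_simp
    have e2 : (s + t) * (t / (s + t)) = t := by field_simp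
    simp only [smul_sub, smul_add, smul_smul, e1, e2]
    abel

/-- The set `K - K` is convex and symmetric, so the absolute values of the coefficients bound the
gauge of a linear combination; `E` is the common denominator produced by Cramer's rule. -/
lemma comb (hK : Convex ℝ K) (h : Chord K 1 v) (h' : Chord K 1 w) {E : ℝ} (hE : 0 < E)
    (a b : ℝ) {x y : ℝ} (hx : a * v.1 + b * w.1 = x * E) (hy : a * v.2 + b * w.2 = y * E)
    (hs : |a| + |b| ≤ s * E) : Chord K s (x, y) := by
  have := ((h.smul (a / E)).add hK (h'.smul (b / E))).mono hK (t := s) (by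
    rwa [abs_div, abs_div, abs_of_pos hE, mul_one, mul_one, ← add_div, div_le_iff₀ hE])
  convert this using 1
  ext
  · simp only [Prod.fst_add, Prod.smul_fst, smul_eq_mul]
    field_simp
    linarith
  · simp only [Prod.snd_add, Prod.smul_snd, smul_eq_mul]
    field_simp
    linarith

lemma shrink (hK : Convex ℝ K) (h : Chord K 1 v) {c : ℝ} (h0 : |c| ≤ 1) : Chord K 1 (c • v) :=
  (h.smul c).mono hK (by simpa using h0)

end Chord

namespace IsFreeBody

variable {K : Set (ℝ × ℝ)}

/-- If `s + t ≤ 1`, a convex combination of two segments in `K` is a parallelogram in `K` whose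
sides are the given basis vectors: a closed fundamental cell, which contains a lattice point. -/
lemma one_lt_add_of_chord (hK : IsFreeBody K) {s t : ℝ} {a b c d : ℤ}
    (hdet : (a * d - b * c) * (a * d - b * c) = 1) (h1 : Chord K s ((a : ℝ), (b : ℝ)))
    (h2 : Chord K t ((c : ℝ), (d : ℝ))) : 1 < s + t := by
  by_contra! hst
  replace h2 := h2.mono hK.convex (t := 1 - s) (by linarith)
  obtain ⟨hs, p, hp, q, hq, h1⟩ := h1
  obtain ⟨ht, p', hp', q', hq', h2⟩ := h2
  have hdet' : ((a : ℝ) * d - b * c) * (a * d - b * c) = 1 := by exact_mod_cast hdet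
  -- A corner of the parallelogram; `X` and `Y` are its coordinates in the basis, and rounding them
  -- up stays inside the cell.
  set o : ℝ × ℝ := s • q + (1 - s) • q' with ho
  set X : ℝ := ((a : ℝ) * d - b * c) * (o.1 * d - o.2 * c) with hX
  set Y : ℝ := ((a : ℝ) * d - b * c) * (o.2 * a - o.1 * b) with hY
  have hx0 : 0 ≤ ⌈X⌉ - X := sub_nonneg.2 (Int.le_ceil X)
  have hx1 : 0 ≤ 1 - (⌈X⌉ - X) := by linarith [Int.ceil_lt_add_one X]
  have hy0 : 0 ≤ ⌈Y⌉ - Y := sub_nonneg.2 (Int.le_ceil Y)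
  have hy1 : 0 ≤ 1 - (⌈Y⌉ - Y) := by linarith [Int.ceil_lt_add_one Y]
  have hmem := hK.convex (hK.convex hp hq hx0 hx1 (by ring))
    (hK.convex hp' hq' hy0 hy1 (by ring)) hs ht (by ring)
  refine hK.free (⌈X⌉ * a + ⌈Y⌉ * c) (⌈X⌉ * b + ⌈Y⌉ * d) ?_
  convert hmem using 1
  simp only [Prod.ext_iff, Prod.smul_fst, Prod.smul_snd, Prod.fst_sub, Prod.snd_sub, smul_eq_mul,
    Prod.fst_add, Prod.snd_add] at h1 h2 ho ⊢
  push_cast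
  constructor
  · linear_combination (⌈X⌉ - X) * h1.1 + (⌈Y⌉ - Y) * h2.1 + o.1 * hdet' + ho.1
  · linear_combination (⌈X⌉ - X) * h1.2 + (⌈Y⌉ - Y) * h2.2 + o.2 * hdet' + ho.2

/-- Cramer's rule bounds the gauges of `(1, 0)`, `(0, 1)` and `(1, 1)`. In each sign or size regime
of `δ` and `β`, two of these bounds sum to at most 1. -/
lemma false_of_chords (hK : IsFreeBody K) {δ β : ℝ} (hA : Chord K 1 (3, δ))
    (hB : Chord K 1 (β, 3)) (hδ0 : 0 ≤ δ) (hδ1 : δ ≤ 3 / 2) (hβ0 : -3 ≤ β) (hβ1 : β ≤ 3)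
    (h : δ ≤ 1 ∨ β ≤ 1) : False := by
  have hΔ : 0 < 9 - δ * β := by nlinarith
  have he1 : Chord K ((3 + δ) / (9 - δ * β)) (1, 0) := by
    refine hA.comb hK.convex hB hΔ 3 (-δ) (by ring) (by ring) ?_
    rw [abs_neg, abs_of_nonneg hδ0, div_mul_cancel₀ _ hΔ.ne']
    norm_num
  have he2 : Chord K ((3 + |β|) / (9 - δ * β)) (0, 1) := by
    refine hA.comb hK.convex hB hΔ (-β) 3 (by ring) (by ring) ?_
    rw [abs_neg, div_mul_cancel₀ _ hΔ.ne', add_comm]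
    norm_num
  have he3 : Chord K ((6 - β - δ) / (9 - δ * β)) (1, 1) := by
    refine hA.comb hK.convex hB hΔ (3 - β) (3 - δ) (by ring) (by ring) ?_
    rw [div_mul_cancel₀ _ hΔ.ne', abs_of_nonneg (by linarith), abs_of_nonneg (by linarith)]
    linarith
  rcases le_total β 0 with hβ | hβ
  · have := hK.one_lt_add_of_chord (a := 1) (b := 0) (c := 0) (d := 1) (by norm_num)
      (by simpa using he1) (by simpa using he2)
    rw [← add_div, lt_div_iff₀ hΔ, abs_of_nonpos hβ] at this
    nlinarith
  · rw [abs_of_nonneg hβ] at he2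
    rcases h with h | h
    · have := hK.one_lt_add_of_chord (a := 1) (b := 0) (c := 1) (d := 1) (by norm_num)
        (by simpa using he1) (by simpa using he3)
      rw [← add_div, lt_div_iff₀ hΔ] at this
      nlinarith
    · have := hK.one_lt_add_of_chord (a := 0) (b := 1) (c := 1) (d := 1) (by norm_num)
        (by simpa using he2) (by simpa using he3)
      rw [← add_div, lt_div_iff₀ hΔ] at this
      nlinarith

/-- The two-chord argument leaves only `δ, β > 1`. There the chord with `x₁ - x₂ = 3` either gives
two basis vectors of gauge at most `1/2`, or, reversed and shortened, replaces the second chord by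
one with `β ≤ 1`. -/
lemma false_of_three_chords (hK : IsFreeBody K) {δ β p : ℝ} (hA : Chord K 1 (3, δ))
    (hB : Chord K 1 (β, 3)) (hC : Chord K 1 (p, p - 3)) (hδ0 : 0 ≤ δ) (hδ1 : δ ≤ 3 / 2)
    (hβ0 : -3 ≤ β) (hβ1 : β ≤ 3) (hp0 : -3 ≤ p) (hp1 : p ≤ 3) : False := by
  by_cases h : δ ≤ 1 ∨ β ≤ 1
  · exact hK.false_of_chords hA hB hδ0 hδ1 hβ0 hβ1 h
  push Not at h
  obtain ⟨hδ, hβ⟩ := h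
  rcases le_total 0 p with hp | hp
  · have hΔ : 0 < 9 - δ * β := by nlinarith
    have hE : 0 < 3 * (3 - p) + δ * p := by nlinarith
    have he3 : Chord K (1 / 2) (1, 1) := by
      refine hA.comb hK.convex hB hΔ (3 - β) (3 - δ) (by ring) (by ring) ?_
      rw [abs_of_nonneg (by linarith), abs_of_nonneg (by linarith)]
      nlinarith
    have he1 : Chord K (1 / 2) (1, 0) := by
      refine hA.comb hK.convex hC hE (3 - p) δ (by ring) (by ring) ?_
      rw [abs_of_nonneg (by linarith), abs_of_nonneg (by linarith)]
      nlinarith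
    have := hK.one_lt_add_of_chord (a := 1) (b := 0) (c := 1) (d := 1) (by norm_num)
        (by simpa using he1) (by simpa using he3)
    norm_num at this
  · have hC' : Chord K 1 (-p, 3 - p) := by
      have := hC.smul (-1)
      simpa using this
    rcases le_or_gt (-p) (3 / 2) with h2 | h2
    · have h3 : 0 < 3 - p := by linarith
      have := hC'.shrink hK.convex (c := 3 / (3 - p)) (by
        rw [abs_of_pos (by positivity), div_le_one h3]
        linarith)
      refine hK.false_of_chords hA (β := 3 * -p / (3 - p)) ?_ hδ0 hδ1 ?_ ?_ (Or.inr ?_)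
      · convert this using 1
        ext
        · simp
          ring
        · simp
          field_simp
      · rw [le_div_iff₀ h3]
        linarith
      · rw [div_le_iff₀ h3]
        linarith
      · rw [div_le_iff₀ h3]
        linarith
    · have hE : 0 < 3 * (3 - p) + δ * p := by nlinarith
      have he3 : Chord K (1 / 2) (1, 1) := by
        refine hA.comb hK.convex hC' hE 3 (3 - δ) (by ring) (by ring) ?_
        rw [abs_of_nonneg (by linarith), abs_of_nonneg (by linarith)]
        nlinarith
      have he2 : Chord K (1 / 2) (0, 1) := by
        refine hA.comb hK.convex hC' hE p 3 (by ring) (by ring) ?_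
        rw [abs_of_nonpos hp, abs_of_nonneg (by linarith)]
        nlinarith
      have := hK.one_lt_add_of_chord (a := 0) (b := 1) (c := 1) (d := 1) (by norm_num)
          (by simpa using he2) (by simpa using he3)
      norm_num at this

lemma false_of_wide_aux (hK : IsFreeBody K) {w : ℝ} (hw : 3 ≤ w)
    (hle : ∀ p ∈ K, ∀ q ∈ K, p.1 - q.1 ≤ w)
    (hA : ∃ p ∈ K, ∃ q ∈ K, p.1 - q.1 = w ∧ 0 ≤ p.2 - q.2 ∧ p.2 - q.2 ≤ w / 2)
    (hB : ∃ p ∈ K, ∃ q ∈ K, w ≤ p.2 - q.2)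
    (hC : ∃ p ∈ K, ∃ q ∈ K, w ≤ (p.1 - p.2) - (q.1 - q.2)) : False := by
  have key : ∀ p ∈ K, ∀ q ∈ K, ∀ y : ℝ, 3 ≤ y → Chord K 1 ((3 / y) • (p - q)) := by
    intro p hp q hq y hy
    refine Chord.shrink hK.convex ⟨zero_le_one, p, hp, q, hq, by simp⟩ ?_
    rw [abs_of_nonneg (by positivity), div_le_one (by linarith)]
    exact hy
  have hbd : ∀ p ∈ K, ∀ q ∈ K, ∀ y : ℝ, w ≤ y →
      -3 ≤ 3 / y * (p.1 - q.1) ∧ 3 / y * (p.1 - q.1) ≤ 3 := by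
    intro p hp q hq y hy
    have h1 := hle p hp q hq
    have h2 := hle q hq p hp
    have hy0 : 0 < y := by linarith
    rw [div_mul_eq_mul_div, le_div_iff₀ hy0, div_le_iff₀ hy0]
    constructor <;> linarith
  obtain ⟨a, ha, a', ha', hA1, hA2, hA3⟩ := hA
  obtain ⟨b, hb, b', hb', hB1⟩ := hB
  obtain ⟨c, hc, c', hc', hC1⟩ := hC
  have hw0 : 0 < w := by linarith
  have hB0 : 0 < b.2 - b'.2 := by linarith
  have hC0 : 0 < (c.1 - c.2) - (c'.1 - c'.2) := by linarith
  refine hK.false_of_three_chords (δ := 3 / w * (a.2 - a'.2))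
    (β := 3 / (b.2 - b'.2) * (b.1 - b'.1))
    (p := 3 / ((c.1 - c.2) - (c'.1 - c'.2)) * (c.1 - c'.1)) ?_ ?_ ?_ (by positivity) ?_
    (hbd _ hb _ hb' _ hB1).1 (hbd _ hb _ hb' _ hB1).2
    (hbd _ hc _ hc' _ hC1).1 (hbd _ hc _ hc' _ hC1).2
  · convert key a ha a' ha' w hw using 1
    ext
    · simp [hA1]
      field_simp
    · simp
  · convert key b hb b' hb' _ (hw.trans hB1) using 1
    ext
    · simp
    · simp
      field_simp
  · convert key c hc c' hc' _ (hw.trans hC1) using 1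
    ext
    · simp
    · simp
      field_simp
      ring
  · rw [div_mul_eq_mul_div, div_le_iff₀ hw0]
    linarith

/-- A free body cannot have width at least `3` in every lattice direction, if the smallest width
is attained. -/
theorem false_of_wide (hK : IsFreeBody K) {w : ℝ} (hw : 3 ≤ w)
    (hle : ∀ p ∈ K, ∀ q ∈ K, p.1 - q.1 ≤ w)
    (hge : ∀ a b : ℤ, IsCoprime a b →
      ∃ p ∈ K, ∃ q ∈ K, w ≤ a * (p.1 - q.1) + b * (p.2 - q.2)) : False := by
  obtain ⟨p, hp, q, hq, hpq⟩ := hge 1 0 isCoprime_one_left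
  simp only [Int.cast_one, one_mul, Int.cast_zero, zero_mul, add_zero] at hpq
  have hpq' := le_antisymm (hle p hp q hq) hpq
  have hw0 : 0 < w := by linarith
  -- Shearing by the nearest integer slope and then reflecting by `ε` brings the slope of the widest
  -- chord into `[0, 1/2]`.
  set k := round ((p.2 - q.2) / w) with hk
  obtain ⟨ε, hε, hε2, hε0⟩ : ∃ ε : ℤ, (ε = 1 ∨ ε = -1) ∧ (ε : ℝ) * ε = 1 ∧
      0 ≤ ε * ((p.2 - q.2) - k * w) := by
    rcases le_total 0 ((p.2 - q.2) - k * w) with h | h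
    · exact ⟨1, Or.inl rfl, by simp, by simpa using h⟩
    · exact ⟨-1, Or.inr rfl, by simp, by push_cast; linarith⟩
  have hdelta : ε * ((p.2 - q.2) - k * w) ≤ w / 2 := by
    have h1 := abs_le.1 (abs_sub_round ((p.2 - q.2) / w))
    rw [← hk] at h1
    have h2 : (p.2 - q.2) = (p.2 - q.2) / w * w := by field_simp
    rw [h2]
    rcases hε with rfl | rfl
    · push_cast
      nlinarith
    · push_cast
      nlinarith
  set g : UnimodularMap := ⟨1, 0, k, ε, 0, 0, by simpa using hε⟩
  have hmem : ∀ z ∈ K, (z.1, ε * (z.2 - k * z.1)) ∈ g.pre K := by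
    intro z hz
    rw [mem_pre]
    convert hz using 1
    ext
    · simp [g]
    · simp only [g, Int.cast_zero, add_zero]
      linear_combination (z.2 - k * z.1) * hε2
  refine (hK.pre g).false_of_wide_aux hw ?_ ?_ ?_ ?_
  · intro z hz z' hz'
    have := hle _ ((mem_pre _ z).1 hz) _ ((mem_pre _ z').1 hz')
    simpa [g] using this
  · refine ⟨_, hmem p hp, _, hmem q hq, hpq', ?_, ?_⟩
    · simp only
      linear_combination hε0 + ε * k * hpq'
    · simp only
      linear_combination hdelta - ε * k * hpq'
  · obtain ⟨z, hz, z', hz', h⟩ := hge (-(ε * k)) ε (by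
      rcases hε with rfl | rfl
      · exact isCoprime_one_right
      · exact isCoprime_one_right.neg_right)
    refine ⟨_, hmem z hz, _, hmem z' hz', ?_⟩
    push_cast at h
    simp only
    linarith
  · obtain ⟨z, hz, z', hz', h⟩ := hge (1 + ε * k) (-ε) (by
      rcases hε with rfl | rfl
      · exact isCoprime_one_right.neg_right
      · simpa using isCoprime_one_right)
    refine ⟨_, hmem z hz, _, hmem z' hz', ?_⟩
    push_cast at h
    simp only
    linarith

end IsFreeBody

/-! ### The direction of least width -/

/-- A free body that is a scaled copy of the convex hull of finitely many integer points is
classified. -/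
theorem IsFreeBody.classified_of_scaled_hull {K : Set (ℝ × ℝ)} (hK : IsFreeBody K) {n : ℝ}
    (hn : 0 < n) (V : Finset (ℤ × ℤ))
    (hV : ∀ p : ℝ × ℝ, p ∈ K ↔
      n • p ∈ convexHull ℝ ((fun v : ℤ × ℤ => ((v.1 : ℝ), (v.2 : ℝ))) '' V)) :
    Classified K := by
  classical
  set ι : ℤ × ℤ → ℝ × ℝ := fun v => ((v.1 : ℝ), (v.2 : ℝ)) with hι
  -- Widths of an integer point set are integers, so a least one exists; direction `(1, 0)` with a
  -- crude bound shows that the set is nonempty.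
  have hex : ∃ w : ℕ, ∃ a b : ℤ, IsCoprime a b ∧ ∀ v ∈ V, ∀ v' ∈ V,
      a * (v.1 - v'.1) + b * (v.2 - v'.2) ≤ w := by
    refine ⟨∑ v ∈ V, ∑ v' ∈ V, (v.1 - v'.1).natAbs, 1, 0, isCoprime_one_left, fun v hv v' hv' => ?_⟩
    have h1 : (v.1 - v'.1).natAbs ≤ ∑ v ∈ V, ∑ v' ∈ V, (v.1 - v'.1).natAbs :=
      (Finset.single_le_sum (f := fun v' : ℤ × ℤ => (v.1 - v'.1).natAbs)
        (fun _ _ => Nat.zero_le _) hv').trans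
      (Finset.single_le_sum (f := fun v : ℤ × ℤ => ∑ v' ∈ V, (v.1 - v'.1).natAbs)
        (fun _ _ => Nat.zero_le _) hv)
    have h2 : v.1 - v'.1 ≤ ((v.1 - v'.1).natAbs : ℤ) := Int.le_natAbs
    have h3 : ((v.1 - v'.1).natAbs : ℤ) ≤
      ((∑ v ∈ V, ∑ v' ∈ V, (v.1 - v'.1).natAbs : ℕ) : ℤ) := by exact_mod_cast h1
    linarith
  obtain ⟨a, b, hab, hle⟩ := Nat.find_spec hex
  have hmin : ∀ m, m < Nat.find hex → _ := fun m hm => Nat.find_min hex hm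
  set w := Nat.find hex
  obtain ⟨u, v, huv⟩ := hab
  have huv' : (u : ℝ) * a + v * b = 1 := by exact_mod_cast huv
  -- Bézout coefficients complete the minimal direction to a basis in which it becomes `x₁`.
  set g : UnimodularMap := ⟨u, -b, v, a, 0, 0, Or.inl (by linarith)⟩ with hg
  have hmem : ∀ p ∈ K, (a * p.1 + b * p.2, -v * p.1 + u * p.2) ∈ g.pre K := by
    intro p hp
    rw [mem_pre]
    convert hp using 1
    ext
    · simp only [hg, Int.cast_neg, Int.cast_zero]
      linear_combination p.1 * huv'
    · simp only [hg, Int.cast_zero]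
      linear_combination p.2 * huv'
  have hbd : ∀ p ∈ K, ∀ q ∈ K, n * (a * (p.1 - q.1) + b * (p.2 - q.2)) ≤ w := by
    intro p hp q hq
    have hcomb : ∀ x : ℝ × ℝ, ∀ s : ℝ, (∀ z ∈ ι '' V, a * z.1 + b * z.2 ≤ s) →
        x ∈ convexHull ℝ (ι '' V) → a * x.1 + b * x.2 ≤ s := by
      intro x s hz hx
      have hc : Convex ℝ {z : ℝ × ℝ | a * z.1 + b * z.2 ≤ s} := by
        intro y hy z hz α β hα hβ hαβ
        simp only [Set.mem_ofPred_eq, Prod.fst_add, Prod.smul_fst, smul_eq_mul, Prod.snd_add,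
          Prod.smul_snd] at hy hz ⊢
        obtain rfl : β = 1 - α := by linarith
        nlinarith
      exact convexHull_min hz hc hx
    have hcomb' : ∀ x : ℝ × ℝ, ∀ s : ℝ, (∀ z ∈ ι '' V, s ≤ a * z.1 + b * z.2) →
        x ∈ convexHull ℝ (ι '' V) → s ≤ a * x.1 + b * x.2 := by
      intro x s hz hx
      have hc : Convex ℝ {z : ℝ × ℝ | s ≤ a * z.1 + b * z.2} := by
        intro y hy z hz α β hα hβ hαβ
        simp only [Set.mem_ofPred_eq, Prod.fst_add, Prod.smul_fst, smul_eq_mul, Prod.snd_add,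
          Prod.smul_snd] at hy hz ⊢
        obtain rfl : β = 1 - α := by linarith
        nlinarith
      exact convexHull_min hz hc hx
    have h1 : ∀ z ∈ ι '' V, a * z.1 + b * z.2 ≤ w + (a * (n * q.1) + b * (n * q.2)) := by
      rintro _ ⟨z, hz, rfl⟩
      have := hcomb' _ (a * z.1 + b * z.2 - w) (by
        rintro _ ⟨z', hz', rfl⟩
        have : ((a * (z.1 - z'.1) + b * (z.2 - z'.2) : ℤ) : ℝ) ≤ w := by
          exact_mod_cast hle z hz z' hz'
        push_cast at this
        simp only [hι]
        linarith) ((hV q).1 hq)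
      simp only [Prod.smul_fst, Prod.smul_snd, smul_eq_mul] at this
      simp only [hι]
      linarith
    have := hcomb _ _ h1 ((hV p).1 hp)
    simp only [Prod.smul_fst, Prod.smul_snd, smul_eq_mul] at this
    linarith
  refine .of_pre g ?_
  by_cases hw : (w : ℝ) / n < 3
  · refine (hK.pre g).classified_of_width_lt hw fun p hp q hq => ?_
    rw [le_div_iff₀ hn]
    have := hbd _ ((mem_pre _ p).1 hp) _ ((mem_pre _ q).1 hq)
    simp only [hg, Int.cast_neg, Int.cast_zero] at this
    linear_combination this - n * (p.1 - q.1) * huv'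
  · push Not at hw
    exfalso
    have hw0 : 0 < w := by
      have : 0 < (w : ℝ) / n := by linarith
      rw [div_pos_iff_of_pos_right hn] at this
      exact_mod_cast this
    refine (hK.pre g).false_of_wide hw (fun p hp q hq => ?_) fun c d hcd => ?_
    · rw [le_div_iff₀ hn]
      have := hbd _ ((mem_pre _ p).1 hp) _ ((mem_pre _ q).1 hq)
      simp only [hg, Int.cast_neg, Int.cast_zero] at this
      linear_combination this - n * (p.1 - q.1) * huv'
    · have hcop : IsCoprime (c * a - d * v) (c * b + d * u) := by
        obtain ⟨s, t, hst⟩ := hcd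
        exact ⟨u * s - b * t, v * s + a * t, by linear_combination (s * c + t * d) * huv + hst⟩
      -- Failure of the bound `w - 1` in the pulled-back primitive direction yields, by integrality,
      -- two vertices at least `w` apart.
      have h1 := hmin (w - 1) (by omega)
      push Not at h1
      obtain ⟨z, hz, z', hz', h2⟩ := h1 _ _ hcop
      have hzK : ∀ z ∈ V, n⁻¹ • ι z ∈ K := by
        intro z hz
        rw [hV, smul_inv_smul₀ hn.ne']
        exact subset_convexHull ℝ _ ⟨z, hz, rfl⟩
      refine ⟨_, hmem _ (hzK z hz), _, hmem _ (hzK z' hz'), ?_⟩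
      have h3 : (w : ℤ) ≤ (c * a - d * v) * (z.1 - z'.1) + (c * b + d * u) * (z.2 - z'.2) := by
        omega
      have h4 : (w : ℝ) ≤ (c * a - d * v) * (z.1 - z'.1) + (c * b + d * u) * (z.2 - z'.2) := by
        exact_mod_cast h3
      rw [div_le_iff₀ hn]
      simp only [hι, Prod.smul_mk, smul_eq_mul]
      have h5 : n * n⁻¹ = 1 := mul_inv_cancel₀ hn.ne'
      linear_combination h4 + ((c * a - d * v) * (z'.1 - z.1) + (c * b + d * u) * (z'.2 - z.2)) * h5

/-! ### Splitting and level sets -/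

section Splitting

variable {Q S : Set (ℝ × ℝ)} {f : ℝ × ℝ → ℝ} {c : ℝ}

lemma nonempty_interior_inter_of_isOpen (hQ : Convex ℝ Q) (hint : (interior Q).Nonempty)
    {U : Set (ℝ × ℝ)} (hU : IsOpen U) (h : (Q ∩ U).Nonempty) : (interior (Q ∩ U)).Nonempty := by
  obtain ⟨p, hp, hpU⟩ := h
  have : p ∈ closure (interior Q) := by
    rw [hQ.closure_interior_eq_closure_of_nonempty_interior hint]
    exact subset_closure hp
  obtain ⟨z, hzU, hz⟩ := mem_closure_iff.1 this U hU hpU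
  exact ⟨z, by rw [interior_inter, hU.interior_eq]; exact ⟨hz, hzU⟩⟩

/-- It is enough that `S` agrees with the level set within `Q`, so segments are treated like lines.
Each open side that meets `Q` also meets its interior, which is dense in `Q`. -/
lemma splits_of_level_set (hQ : Convex ℝ Q) (hint : (interior Q).Nonempty) (hf : Continuous f)
    (hS : ∀ p ∈ Q, p ∈ S ↔ f p = c) (h1 : ∃ p ∈ Q, f p < c) (h2 : ∃ p ∈ Q, c < f p) :
    Splits S Q := by
  refine ⟨Q ∩ {p | f p < c}, Q ∩ {p | c < f p}, ?_, ?_, ?_, ?_, ?_⟩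
  · ext p
    constructor
    · rintro (⟨hp, h⟩ | ⟨hp, h⟩)
      · exact ⟨hp, fun hs => h.ne ((hS p hp).1 hs)⟩
      · exact ⟨hp, fun hs => h.ne' ((hS p hp).1 hs)⟩
    · rintro ⟨hp, h⟩
      rw [hS p hp] at h
      rcases lt_or_gt_of_ne h with h | h
      · exact Or.inl ⟨hp, h⟩
      · exact Or.inr ⟨hp, h⟩
  · exact nonempty_interior_inter_of_isOpen hQ hint (isOpen_lt hf continuous_const) h1
  · exact nonempty_interior_inter_of_isOpen hQ hint (isOpen_lt continuous_const hf) h2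
  · refine Set.disjoint_left.2 fun p hp hp' => ?_
    have : closure (Q ∩ {p | f p < c}) ⊆ {p | f p ≤ c} :=
      closure_minimal (fun z hz => le_of_lt (α := ℝ) hz.2) (isClosed_le hf continuous_const)
    exact not_lt_of_ge (α := ℝ) (this hp) hp'.2
  · refine Set.disjoint_right.2 fun p hp hp' => ?_
    have : closure (Q ∩ {p | c < f p}) ⊆ {p | c ≤ f p} :=
      closure_minimal (fun z hz => le_of_lt (α := ℝ) hz.2) (isClosed_le continuous_const hf)
    exact not_lt_of_ge (α := ℝ) (this hp) hp'.2

/-- A convex remainder is connected and hence admits no separation into two nonempty parts. -/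
lemma not_splits_of_convex_diff (h : Convex ℝ (Q \ S)) : ¬ Splits S Q := by
  rintro ⟨A, B, hAB, hA, hB, h1, h2⟩
  obtain ⟨a, ha⟩ := hA
  obtain ⟨b, hb⟩ := hB
  have ha := interior_subset ha
  have hb := interior_subset hb
  rw [← hAB] at h
  obtain ⟨z, hz, hzA, hzB⟩ := isPreconnected_closed_iff.1 h.isPreconnected (closure A) (closure B)
    isClosed_closure isClosed_closure (Set.union_subset_union subset_closure subset_closure)
    ⟨a, Or.inl ha, subset_closure ha⟩ ⟨b, Or.inr hb, subset_closure hb⟩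
  rcases hz with hz | hz
  · exact Set.disjoint_left.1 h2 hz hzB
  · exact Set.disjoint_left.1 h1 hzA hz

lemma not_splits_of_le (hQ : Convex ℝ Q) (f : (ℝ × ℝ) →ₗ[ℝ] ℝ) (hS : ∀ p ∈ Q, p ∈ S ↔ f p = c)
    (h : ∀ p ∈ Q, c ≤ f p) : ¬ Splits S Q := by
  refine not_splits_of_convex_diff ?_
  have : Q \ S = Q ∩ {p | c < f p} := by
    ext p
    constructor
    · rintro ⟨hp, hs⟩
      exact ⟨hp, lt_of_le_of_ne (h p hp) fun e => hs ((hS p hp).2 e.symm)⟩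
    · rintro ⟨hp, hs⟩
      exact ⟨hp, fun e => ne_of_gt (α := ℝ) hs ((hS p hp).1 e)⟩
  rw [this]
  exact hQ.inter (convex_halfSpace_gt f.isLinear c)

lemma not_splits_of_ge (hQ : Convex ℝ Q) (f : (ℝ × ℝ) →ₗ[ℝ] ℝ) (hS : ∀ p ∈ Q, p ∈ S ↔ f p = c)
    (h : ∀ p ∈ Q, f p ≤ c) : ¬ Splits S Q :=
  not_splits_of_le hQ (-f) (c := -c) (fun p hp => by simp [hS p hp]) fun p hp => by
    simpa using h p hp

lemma not_splits_vLine_of_le (hQ : Convex ℝ Q) (h : ∀ p ∈ Q, c ≤ p.1) : ¬ Splits (vLine c) Q :=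
  not_splits_of_le hQ (LinearMap.fst ℝ ℝ ℝ) (fun _ _ => Iff.rfl) h

lemma not_splits_vLine_of_ge (hQ : Convex ℝ Q) (h : ∀ p ∈ Q, p.1 ≤ c) : ¬ Splits (vLine c) Q :=
  not_splits_of_ge hQ (LinearMap.fst ℝ ℝ ℝ) (fun _ _ => Iff.rfl) h

lemma not_splits_hLine_of_ge (hQ : Convex ℝ Q) (h : ∀ p ∈ Q, p.2 ≤ c) : ¬ Splits (hLine c) Q :=
  not_splits_of_ge hQ (LinearMap.snd ℝ ℝ ℝ) (fun _ _ => Iff.rfl) h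

end Splitting

/-! ### From crossed unit edges to splitting segments -/

section Scaling

variable {K Q : Set (ℝ × ℝ)} {n : ℝ}

/-- By uniqueness of the gap, `Q` meets the whole line only inside this segment, so the segment cuts
`Q` exactly as the line does. -/
lemma HCross.splits (hn : 0 < n) (hKQ : ∀ p : ℝ × ℝ, p ∈ K ↔ n • p ∈ Q) (hK : IsFreeBody K)
    (hQ : Convex ℝ Q) (hint : (interior Q).Nonempty) (i j : ℤ) (h : HCross K i j)
    {x₀ x₁ y : ℝ} (hx₀ : x₀ = n * i) (hx₁ : x₁ = n * (i + 1)) (hy : y = n * j) :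
    Splits (segment ℝ (x₀, y) (x₁, y)) Q := by
  obtain ⟨⟨p, hp, hp1⟩, ⟨q, hq, hq1⟩, t, ht0, ht1, ht⟩ := h
  subst hx₀ hx₁ hy
  refine splits_of_level_set hQ hint continuous_snd (c := n * j) (fun z hz => ?_)
    ⟨_, (hKQ p).1 hp, by simpa using mul_lt_mul_of_pos_left hp1 hn⟩
    ⟨_, (hKQ q).1 hq, by simpa using mul_lt_mul_of_pos_left hq1 hn⟩
  rw [← Prod.image_mk_segment_left, segment_eq_Icc (by nlinarith)]
  constructor
  · rintro ⟨x, -, rfl⟩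
    rfl
  · intro hz2
    have hz' : (z.1 / n, (j : ℝ)) ∈ K := by
      rw [hKQ]
      convert hz using 1
      ext
      · simp
        field_simp
      · simp [hz2]
    have := hK.horiz_unique j i ht hz' ht0 ht1
    rw [lt_div_iff₀ hn, div_lt_iff₀ hn] at this
    exact ⟨z.1, ⟨by linarith, by linarith⟩, by ext <;> simp [hz2]⟩

lemma VCross.splits (hn : 0 < n) (hKQ : ∀ p : ℝ × ℝ, p ∈ K ↔ n • p ∈ Q) (hK : IsFreeBody K)
    (hQ : Convex ℝ Q) (hint : (interior Q).Nonempty) (i j : ℤ) (h : VCross K i j)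
    {y₀ y₁ x : ℝ} (hy₀ : y₀ = n * j) (hy₁ : y₁ = n * (j + 1)) (hx : x = n * i) :
    Splits (segment ℝ (x, y₀) (x, y₁)) Q := by
  obtain ⟨⟨p, hp, hp1⟩, ⟨q, hq, hq1⟩, t, ht0, ht1, ht⟩ := h
  subst hy₀ hy₁ hx
  refine splits_of_level_set hQ hint continuous_fst (c := n * i) (fun z hz => ?_)
    ⟨_, (hKQ p).1 hp, by simpa using mul_lt_mul_of_pos_left hp1 hn⟩
    ⟨_, (hKQ q).1 hq, by simpa using mul_lt_mul_of_pos_left hq1 hn⟩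
  rw [← Prod.image_mk_segment_right, segment_eq_Icc (by nlinarith)]
  constructor
  · rintro ⟨x, -, rfl⟩
    rfl
  · intro hz2
    have hz' : ((i : ℝ), z.2 / n) ∈ K := by
      rw [hKQ]
      convert hz using 1
      ext
      · simp [hz2]
      · simp
        field_simp
    have := hK.vert_unique i j ht hz' ht0 ht1
    rw [lt_div_iff₀ hn, div_lt_iff₀ hn] at this
    exact ⟨z.2, ⟨by linarith, by linarith⟩, by ext <;> simp [hz2]⟩

end Scaling

/-- The six types for `ℤ²` give the six types for `nℤ²` after scaling. -/
lemma UnitType.isType {K Q : Set (ℝ × ℝ)} {n : ℤ} (hn : 0 < n) (h : UnitType K)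
    (hK : IsFreeBody K) (hKQ : ∀ p : ℝ × ℝ, p ∈ K ↔ (n : ℝ) • p ∈ Q)
    (hQ : IsFreeIntegerPolygon n Q) :
    IsTypeI n Q ∨ IsTypeII n Q ∨ IsTypeIII n Q ∨ IsTypeIV n Q ∨ IsTypeV n Q ∨ IsTypeVI n Q := by
  have hn' : (0 : ℝ) < n := by exact_mod_cast hn
  have hc : Convex ℝ Q := by
    obtain ⟨⟨⟨⟨S, rfl⟩, -⟩, -⟩, -⟩ := hQ
    exact convex_convexHull ℝ _
  have hi : (interior Q).Nonempty := hQ.1.1.2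
  have hsp : ∀ p ∈ Q, (n : ℝ)⁻¹ • p ∈ K := fun p hp => by rwa [hKQ, smul_inv_smul₀ hn'.ne']
  have hdiv : ∀ p ∈ Q, ∃ q ∈ K, p.1 = n * q.1 ∧ p.2 = n * q.2 := by
    intro p hp
    refine ⟨_, hsp p hp, ?_, ?_⟩
    · simp [mul_inv_cancel_left₀ hn'.ne']
    · simp [mul_inv_cancel_left₀ hn'.ne']
  have H : ∀ i j : ℤ, HCross K i j → ∀ x₀ x₁ y : ℝ, x₀ = n * i → x₁ = n * (i + 1) → y = n * j →
      Splits (segment ℝ (x₀, y) (x₁, y)) Q := fun i j h x₀ x₁ y h1 h2 h3 =>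
    HCross.splits hn' hKQ hK hc hi i j h h1 h2 h3
  have V : ∀ i j : ℤ, VCross K i j → ∀ y₀ y₁ x : ℝ, y₀ = n * j → y₁ = n * (j + 1) → x = n * i →
      Splits (segment ℝ (x, y₀) (x, y₁)) Q := fun i j h y₀ y₁ x h1 h2 h3 =>
    VCross.splits hn' hKQ hK hc hi i j h h1 h2 h3
  rcases h with h | ⟨hb, hr, ht, hl⟩ | ⟨hb, hr, ht, hl⟩ | ⟨hl, hb, hr, ht, h⟩ | ⟨hb, hr, h⟩ |
    ⟨hb, hr, ht, h⟩
  · refine Or.inl ⟨hQ, 0, Or.inl fun p hp => ?_⟩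
    obtain ⟨q, hq, h1, -⟩ := hdiv p hp
    obtain ⟨h2, h3⟩ := h q hq
    rw [h1]
    push_cast
    constructor <;> nlinarith
  · refine Or.inr (Or.inl ⟨hQ, ?_, ?_, ?_, ?_⟩)
    · exact H 0 0 (by simpa using hb) _ _ _ (by simp) (by simp) (by simp)
    · exact V 1 0 (by simpa using hr) _ _ _ (by simp) (by simp) (by simp)
    · exact H 0 1 (by simpa using ht) _ _ _ (by simp) (by simp) (by simp)
    · exact V 0 0 (by simpa using hl) _ _ _ (by simp) (by simp) (by simp)
  · refine Or.inr (Or.inr (Or.inl ⟨hQ, ?_, ?_, ?_, ?_⟩))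
    · exact H 0 0 (by simpa using hb) _ _ _ (by simp) (by simp) (by simp)
    · exact V 1 0 (by simpa using hr) _ _ _ (by simp) (by simp) (by simp)
    · rw [segment_symm]
      exact H 0 1 (by simpa using ht) _ _ _ (by simp) (by simp) (by simp)
    · refine not_splits_vLine_of_le hc fun p hp => ?_
      obtain ⟨q, hq, h1, -⟩ := hdiv p hp
      rw [h1]
      exact mul_nonneg hn'.le (hl q hq)
  · refine Or.inr (Or.inr (Or.inr (Or.inl ⟨hQ, ?_, ?_, ?_, ?_, ?_, ?_⟩)))
    · exact V 0 0 (by simpa using hl) _ _ _ (by simp) (by simp) (by simp)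
    · exact H 0 0 (by simpa using hb) _ _ _ (by simp) (by simp) (by simp)
    · exact V 1 0 (by simpa using hr) _ _ _ (by simp) (by simp) (by simp)
    · exact H 1 1 (by simpa using ht) _ _ _ (by simp) (by push_cast; ring) (by simp)
    · refine Set.disjoint_left.2 fun p hp hp' => ?_
      obtain ⟨q, hq, h1, -⟩ := hdiv p hp
      have : p.1 = -n := hp'
      have := (h q hq).1
      nlinarith
    · refine Set.disjoint_left.2 fun p hp hp' => ?_
      obtain ⟨q, hq, h1, -⟩ := hdiv p hp
      have : p.1 = 2 * n := hp'
      have := (h q hq).2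
      nlinarith
  · refine Or.inr (Or.inr (Or.inr (Or.inr (Or.inl ⟨hQ, ?_, ?_, ?_, ?_⟩))))
    · rw [segment_symm]
      exact H (-1) 0 (by simpa using hb) _ _ _ (by simp) (by simp) (by simp)
    · exact V 0 0 (by simpa using hr) _ _ _ (by simp) (by simp) (by simp)
    · refine not_splits_vLine_of_le hc fun p hp => ?_
      obtain ⟨q, hq, h1, -⟩ := hdiv p hp
      have := (h q hq).1
      nlinarith
    · refine not_splits_hLine_of_ge hc fun p hp => ?_
      obtain ⟨q, hq, -, h1⟩ := hdiv p hp
      have := (h q hq).2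
      nlinarith
  · refine Or.inr (Or.inr (Or.inr (Or.inr (Or.inr ⟨hQ, ?_, ?_, ?_, ?_, ?_⟩))))
    · rw [segment_symm]
      exact H (-1) 0 (by simpa using hb) _ _ _ (by simp) (by simp) (by simp)
    · exact V 0 0 (by simpa using hr) _ _ _ (by simp) (by simp) (by simp)
    · exact H 0 1 (by simpa using ht) _ _ _ (by simp) (by simp) (by simp)
    · refine not_splits_vLine_of_ge hc fun p hp => ?_
      obtain ⟨q, hq, h1, -⟩ := hdiv p hp
      have := (h q hq).2
      nlinarith
    · refine not_splits_vLine_of_le hc fun p hp => ?_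
      obtain ⟨q, hq, h1, -⟩ := hdiv p hp
      have := (h q hq).1
      nlinarith

/-! ### Automorphisms of `nℤ²` and the conclusion -/

namespace UnimodularMap

/-- The linear part of a unimodular map. -/
noncomputable def toLinearEquiv (g : UnimodularMap) : (ℝ × ℝ) ≃ₗ[ℝ] (ℝ × ℝ) where
  toFun := (⟨g.a, g.b, g.c, g.d, 0, 0, g.det⟩ : UnimodularMap).toFun
  invFun := (⟨g.a, g.b, g.c, g.d, 0, 0, g.det⟩ : UnimodularMap).inv.toFun
  left_inv := inv_toFun _
  right_inv := toFun_inv _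
  map_add' p q := by
    ext
    · simp [toFun]
      ring
    · simp [toFun]
      ring
  map_smul' s p := by
    ext
    · simp [toFun]
      ring
    · simp [toFun]
      ring

/-- A unimodular map as an affine equivalence of the plane. -/
noncomputable def toAffineEquiv (g : UnimodularMap) : (ℝ × ℝ) ≃ᵃ[ℝ] (ℝ × ℝ) where
  toFun := g.toFun
  invFun := g.inv.toFun
  left_inv := g.inv_toFun
  right_inv := g.toFun_inv
  linear := g.toLinearEquiv
  map_vadd' p v := by
    ext
    · simp [toLinearEquiv, toFun]
      ring
    · simp [toLinearEquiv, toFun]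
      ring

/-- The unimodular map with the translation part multiplied by `n`. -/
def scale (g : UnimodularMap) (n : ℤ) : UnimodularMap :=
  ⟨g.a, g.b, g.c, g.d, n * g.e, n * g.f, g.det⟩

lemma toFun_scale_smul (g : UnimodularMap) (n : ℤ) (p : ℝ × ℝ) :
    (g.scale n).toFun ((n : ℝ) • p) = (n : ℝ) • g.toFun p := by
  ext
  · simp [toFun, scale]
    ring
  · simp [toFun, scale]
    ring

lemma mem_scaledLattice {n : ℤ} {p : ℝ × ℝ} :
    p ∈ scaledLattice n ↔ ∃ u v : ℤ, p = (n : ℝ) • ((u : ℝ), (v : ℝ)) := Iff.rfl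

lemma toFun_intCast (g : UnimodularMap) (u v : ℤ) :
    g.toFun ((u : ℝ), (v : ℝ)) =
      (((g.a * u + g.b * v + g.e : ℤ) : ℝ), ((g.c * u + g.d * v + g.f : ℤ) : ℝ)) := by
  simp [toFun]

lemma toFun_scale_mem (g : UnimodularMap) {n : ℤ} {p : ℝ × ℝ} (hp : p ∈ scaledLattice n) :
    (g.scale n).toFun p ∈ scaledLattice n := by
  obtain ⟨u, v, rfl⟩ := mem_scaledLattice.1 hp
  exact mem_scaledLattice.2 ⟨_, _, by rw [toFun_scale_smul, toFun_intCast]⟩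

lemma inv_scale_toFun_mem (g : UnimodularMap) {n : ℤ} {p : ℝ × ℝ} (hp : p ∈ scaledLattice n) :
    (g.scale n).inv.toFun p ∈ scaledLattice n := by
  obtain ⟨u, v, rfl⟩ := mem_scaledLattice.1 hp
  refine mem_scaledLattice.2 ⟨g.inv.a * u + g.inv.b * v + g.inv.e,
    g.inv.c * u + g.inv.d * v + g.inv.f, ?_⟩
  rw [← toFun_intCast]
  conv_lhs => rw [← g.toFun_inv ((u : ℝ), (v : ℝ)), ← toFun_scale_smul, inv_toFun]

end UnimodularMap

/-- A polygon has finitely many extreme points, and by Krein–Milman it is their hull; the closure is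
harmless because the hull of a finite set is closed. -/
lemma IsIntegerPolygon.exists_eq_convexHull {P : Set (ℝ × ℝ)} (hP : IsIntegerPolygon P) :
    ∃ V : Finset (ℤ × ℤ), P = convexHull ℝ ((fun v : ℤ × ℤ => ((v.1 : ℝ), (v.2 : ℝ))) '' V) := by
  obtain ⟨⟨⟨S, hS⟩, -⟩, hext⟩ := hP
  have hfin : (P.extremePoints ℝ).Finite :=
    S.finite_toSet.subset (by rw [hS]; exact extremePoints_convexHull_subset)
  have hKM : convexHull ℝ (P.extremePoints ℝ) = P := by
    rw [← (hfin.isClosed_convexHull ℝ).closure_eq]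
    refine closure_convexHull_extremePoints ?_ ?_
    · rw [hS]
      exact S.finite_toSet.isCompact_convexHull ℝ
    · rw [hS]
      exact convex_convexHull ℝ _
  have hinj : Function.Injective (fun v : ℤ × ℤ => ((v.1 : ℝ), (v.2 : ℝ))) := by
    intro v w h
    simpa [Prod.ext_iff] using h
  refine ⟨(hfin.preimage hinj.injOn).toFinset, ?_⟩
  rw [Set.Finite.coe_toFinset, Set.image_preimage_eq_of_subset, hKM]
  intro p hp
  obtain ⟨u, v, rfl⟩ := hext hp
  exact ⟨(u, v), rfl⟩

lemma IsIntegerPolygon.image {P : Set (ℝ × ℝ)} (hP : IsIntegerPolygon P) (g : UnimodularMap) :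
    IsIntegerPolygon (g.toAffineEquiv.symm '' P) := by
  classical
  obtain ⟨V, hV⟩ := hP.exists_eq_convexHull
  set ι : ℤ × ℤ → ℝ × ℝ := fun v => ((v.1 : ℝ), (v.2 : ℝ)) with hι
  have himg : g.toAffineEquiv.symm '' P = convexHull ℝ (g.toAffineEquiv.symm '' (ι '' V)) := by
    rw [hV]
    exact AffineMap.image_convexHull g.toAffineEquiv.symm.toAffineMap _
  refine ⟨⟨⟨(V.image ι).image g.toAffineEquiv.symm, ?_⟩, ?_⟩, ?_⟩
  · rw [himg]
    simp
  · obtain ⟨p, hp⟩ := hP.1.2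
    refine ⟨g.inv.toFun p, ?_⟩
    have : g.toAffineEquiv.symm '' P = g.toFun ⁻¹' P :=
      g.toAffineEquiv.symm.toEquiv.image_eq_preimage_symm P
    rw [this]
    refine preimage_interior_subset_interior_preimage g.continuous_toFun ?_
    simpa only [Set.mem_preimage, toFun_inv] using hp
  · rw [himg]
    refine extremePoints_convexHull_subset.trans ?_
    rintro _ ⟨_, ⟨v, -, rfl⟩, rfl⟩
    exact ⟨_, _, g.inv.toFun_intCast v.1 v.2⟩

theorem mainTheorem4 (n : ℤ) (hn : 2 ≤ n) (P : Set (ℝ × ℝ))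
    (hP : IsIntegerPolygon P) (hfree : Disjoint P (scaledLattice n)) :
    ∃ φ : (ℝ × ℝ) ≃ᵃ[ℝ] (ℝ × ℝ), IsAffineAutomorphism φ (scaledLattice n) ∧
      (IsTypeI n (φ '' P) ∨ IsTypeII n (φ '' P) ∨ IsTypeIII n (φ '' P) ∨
        IsTypeIV n (φ '' P) ∨ IsTypeV n (φ '' P) ∨ IsTypeVI n (φ '' P)) := by
  have hn0 : 0 < n := by linarith
  have hn' : (0 : ℝ) < n := by exact_mod_cast hn0
  obtain ⟨V, hV⟩ := hP.exists_eq_convexHull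
  have hK : IsFreeBody ((fun p : ℝ × ℝ => (n : ℝ) • p) ⁻¹' P) := by
    refine ⟨?_, ?_, ?_⟩
    · have : Convex ℝ P := by
        rw [hV]
        exact convex_convexHull ℝ _
      exact this.smul_preimage (n : ℝ)
    · exact fun u v h => Set.disjoint_left.1 hfree h ⟨u, v, rfl⟩
    · obtain ⟨p, hp⟩ := hP.1.2
      refine ⟨(n : ℝ)⁻¹ • p, preimage_interior_subset_interior_preimage
        (continuous_const_smul _) ?_⟩
      simpa only [Set.mem_preimage, smul_inv_smul₀ hn'.ne'] using hp
  obtain ⟨g, hg⟩ := hK.classified_of_scaled_hull hn' V fun p => by rw [← hV]; rfl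
  have himg : (g.scale n).toAffineEquiv.symm '' P = (g.scale n).toFun ⁻¹' P :=
    (g.scale n).toAffineEquiv.symm.toEquiv.image_eq_preimage_symm P
  -- Types were established for preimages under `g`, so the automorphism is the inverse of `g` with
  -- its translation part multiplied by `n`.
  refine ⟨(g.scale n).toAffineEquiv.symm, ?_, hg.isType hn0 (hK.pre g) (fun p => ?_)
    ⟨hP.image _, ?_⟩⟩
  · refine Set.Subset.antisymm ?_ fun p hp => ?_
    · rintro _ ⟨p, hp, rfl⟩
      exact g.inv_scale_toFun_mem hp
    · exact ⟨_, g.toFun_scale_mem hp, (g.scale n).inv_toFun p⟩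
  · rw [himg, Set.mem_preimage, toFun_scale_smul]
    rfl
  · rw [himg]
    exact Set.disjoint_left.2 fun p hp hp' =>
      Set.disjoint_left.1 hfree hp (g.toFun_scale_mem hp')
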